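/- **Conventions.** A *distance space* is a set $X$ with $d_X:X\times X\to[0,\infty]$ satisfying $d_X(x,x)=0$, symmetry and the triangle inequality. Let $F:\mathbf{Set}\to\mathbf{Set}$ be a (covariant) functor with *finite supports*: every $a\in FX$ lies in $F[A;X]:=Fi_{A,X}[FA]$ for some finite $A\subseteq X$, where $i_{A,X}:A\to X$ is the inclusion. Put $\mathrm{supp}(a)=\bigcap\{A\subseteq X: a\in F[A;X]\}$. The functor $F$ has *finite degree* if for some $n\in\{0,1,2,\dots\}$ we have $|\mathrm{supp}(a)|\le n$ for all sets $X$ and all $a\in FX$; the least such $n$ is $\deg(F)$. The functor $F$ is *finitary* if $FX$ is finite for every finite $X$. Each natural number $n$ is identified with the set $\{0,\dots,n-1\}$. For $p\in[1,\infty]$ and a distance space $X$, $F^pX$ is the distance space $(FX,d^p_{FX})$, where $d^p_{FX}(a,b)$ is the infimum (with $\inf\emptyset=\infty$) of the sums $\sum_{i=0}^l d^p_{X^{n_i}}(f_i,g_i)$ over all finite sequences of triples $(a_i,f_i,g_i)\in F n_i\times X^{n_i}\times X^{n_i}$, $0\le i\le l$, with $l\ge 0$, $n_i\ge0$, such that $a=Ff_0(a_0)$,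 $Fg_i(a_i)=Ff_{i+1}(a_{i+1})$ for $0\le i<l$ and $Fg_l(a_l)=b$; here $d^p_{X^n}$ is the $\ell^p$-distance on $X^n$. For an integer $k\ge0$ let $F^p_kX=\{a\in F^pX:|\mathrm{supp}(a)|\le k\}$, as a subspace of $F^pX$. A *dimension controlling function* is a non-decreasing function $D:(0,\infty)\to(0,\infty]$. For a function $D:(0,\infty)\to[0,\infty]$, the *$D$-controlled dimension* $\dim_DX$ is the least cardinal $\kappa$ such that for every $\varepsilon\in(0,\infty)$ there is a cover $\mathcal U=\bigcup_{i\in 1+\kappa}\mathcal U_i$ of $X$ all of whose members have diameter $\le D(\varepsilon)$ and such that, for each $i$, any two distinct members $U,V$ of $\mathcal U_i$ satisfy $d_X(u,v)\ge\varepsilon$ for all $u\in U$, $v\in V$. A *dimension controlling scale* is a family $\mathcal D$ of dimension controlling functions which contains the identity, contains $f+g$ and $f\circ g$ for all $f,g\in\mathcal D$ (where $f(\infty)=\infty$), and contains every non-decreasing $g:(0,\infty)\to(0,\infty]$ with $g\le f$ for some $f\in\mathcal D$. Put $\dim_{\mathcal D}X=\min_{D\in\mathcal D}\dim_DX$. **Theorem.**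 Let $F$ be a finitary functor with finite supports and finite degree, and let $p\in[1,\infty]$. 1. For every dimension controlling scale $\mathcal D$ and every distance space $X$, $$\dim_{\mathcal D}F^pX\le\deg(F)\cdot\dim_{\mathcal D}X.$$ 2. Let $n=\max\{1,\deg(F)\}$, let $D$ be a dimension controlling function and let $X$ be a distance space for which $m=\dim_DX$ is finite. Put $D(0)=0$, $D(\infty)=\infty$, let $D_0(\varepsilon)=0$, $D_1(\varepsilon)=D(n^{1-\frac1p}\varepsilon)$ and, for $k\ge2$, with $\eta_k(\varepsilon)=2n\cdot|Fn|\cdot3^{km-m+1}\varepsilon$ and $\delta_k(\varepsilon)=D(\eta_k(\varepsilon))+\eta_k(\varepsilon)$, $$D_k(\varepsilon)=(2+4n|Fn|)\varepsilon+2k^{\frac1p}\delta_k(\varepsilon)+D_{k-1}\big(2\varepsilon(1+n|Fn|)+k^{\frac1p}\delta_k(\varepsilon)\big),$$ where each $D_k$ is also extended by $D_k(0)=0$, $D_k(\infty)=\infty$. Then $\dim_{D_k}F^p_kX\le k\cdot\dim_DX$ for every $k\le\deg(F)$, and $\dim_{D_n}F^pX\le\deg(F)\cdot\dim_DX$. 3.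 If in (2) the cardinal $\dim_DX$ is infinite and the functions $D_k$ are defined by the same formulas with the exponent $km-m+1$ replaced by $k^2-2k+2$, then $\dim_{D_k}F^p_kX\le\dim_DX$ for every $k\le\deg(F)$, and $\dim_{D_n}F^pX\le\dim_DX$. 4. The following families are dimension controlling scales: the family $\mathcal{AN}$ of all non-decreasing $f:(0,\infty)\to(0,\infty)$ with $\sup_{x>0}f(x)/x<\infty$; the family $\mathcal{AS}$ of all non-decreasing $f:(0,\infty)\to(0,\infty)$; and the family $\mathcal U$ of all non-decreasing $f:(0,\infty)\to(0,\infty]$ with $\lim_{x\to+0}f(x)=0$. Consequently, for every distance space $X$, the inequality $\dim_{\mathcal D}F^pX\le\deg(F)\cdot\dim_{\mathcal D}X$ holds for the Assouad–Nagata dimension $\dim_{\mathcal{AN}}$, Gromov's asymptotic dimension $\dim_{\mathcal{AS}}$ and Isbell's uniform dimension $\dim_{\mathcal U}$. -/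

import Mathlib

open CategoryTheory
open scoped ENNReal

universe u

namespace LpMetr

noncomputable section

/-! ### Functors from sets to sets: supports and degree -/

/-- The finite ordinal `n = {0, …, n-1}` as a set in the universe `u`. -/
abbrev Ord (n : ℕ) : Type u := ULift.{u} (Fin n)

/-- The function `Ff : FX → FY` induced by a function `f : X → Y`. -/
def fmap (F : Type u ⥤ Type u) {X Y : Type u} (f : X → Y) : F.obj X → F.obj Y :=
  fun a => F.map (TypeCat.ofHom f) a

/-- `F[A;X] ⊆ FX`, the image of `FA` under the map induced by the inclusion `A → X`. -/
def imageOf (F : Type u ⥤ Type u) {X : Type u} (A : Set X) : Set (F.obj X) :=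
  Set.range (fmap F (Subtype.val : A → X))

/-- `F` has finite supports: every `a ∈ FX` belongs to `F[A;X]` for some finite `A ⊆ X`. -/
class FiniteSupports (F : Type u ⥤ Type u) : Prop where
  exists_finite : ∀ (X : Type u) (a : F.obj X), ∃ A : Set X, A.Finite ∧ a ∈ imageOf F A

/-- The support of `a ∈ FX`: the intersection of all `A ⊆ X` with `a ∈ F[A;X]`. -/
def supp (F : Type u ⥤ Type u) {X : Type u} (a : F.obj X) : Set X :=
  ⋂₀ {A : Set X | a ∈ imageOf F A}

/-- `F` has degree at most `n`: all supports have at most `n` elements. -/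
def HasDegreeLE (F : Type u ⥤ Type u) (n : ℕ) : Prop :=
  ∀ (X : Type u) (a : F.obj X), (supp F a).encard ≤ n

/-- `F` has finite degree. -/
def HasFiniteDegree (F : Type u ⥤ Type u) : Prop := ∃ n : ℕ, HasDegreeLE F n

/-- The degree of a functor of finite degree: the least `n` such that `F` has degree `≤ n`. -/
def deg (F : Type u ⥤ Type u) : ℕ := sInf {n : ℕ | HasDegreeLE F n}

/-- `F` is finitary: it sends finite sets to finite sets. -/
def IsFinitary (F : Type u ⥤ Type u) : Prop := ∀ X : Type u, Finite X → Finite (F.obj X)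

/-! ### The `ℓ^p`-metrization.  Distance spaces are `PseudoEMetricSpace`s. -/

/-- A triple `(a, f, g) ∈ Fn × Xⁿ × Xⁿ` for some finite ordinal `n`. -/
structure Link (F : Type u ⥤ Type u) (X : Type u) where
  n : ℕ
  a : F.obj (Ord.{u} n)
  f : Ord.{u} n → X
  g : Ord.{u} n → X

/-- The element `Ff(a)` at which a link `(a, f, g)` starts. -/
def Link.src {F : Type u ⥤ Type u} {X : Type u} (t : Link F X) : F.obj X := fmap F t.f t.a

/-- The element `Fg(a)` at which a link `(a, f, g)` ends. -/
def Link.tgt {F : Type u ⥤ Type u} {X : Type u} (t : Link F X) : F.obj X := fmap F t.g t.a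

/-- The `ℓ^p`-distance between the functions `f` and `g` of a link. -/
def Link.cost {F : Type u ⥤ Type u} {X : Type u} [PseudoEMetricSpace X] (p : ℝ≥0∞)
    (t : Link F X) : ℝ≥0∞ :=
  edist (WithLp.toLp p t.f : PiLp p fun _ : Ord.{u} t.n => X) (WithLp.toLp p t.g)

/-- `IsLinkingChain a s b`: the nonempty finite sequence `s` of links is an `(a,b)`-linking chain,
i.e. its first link starts at `a`, every next link starts where the preceding one ends, and the
last link ends at `b`. -/
inductive IsLinkingChain {F : Type u ⥤ Type u} {X : Type u} :
    F.obj X → List (Link F X) → F.obj X → Prop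
  | single (t : Link F X) : IsLinkingChain t.src [t] t.tgt
  | cons (t : Link F X) (s : List (Link F X)) (b : F.obj X) (h : IsLinkingChain t.tgt s b) :
      IsLinkingChain t.src (t :: s) b

/-- The distance `d^p_{FX}(a,b)`: the infimum of the total costs of all `(a,b)`-linking chains. -/
def lpDist (F : Type u ⥤ Type u) (p : ℝ≥0∞) (X : Type u) [PseudoEMetricSpace X]
    (a b : F.obj X) : ℝ≥0∞ :=
  ⨅ (s : List (Link F X)) (_ : IsLinkingChain a s b), (s.map (Link.cost p)).sum

theorem IsLinkingChain.append {F : Type u ⥤ Type u} {X : Type u} {a b c : F.obj X}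
    {s s' : List (Link F X)} (h : IsLinkingChain a s b) (h' : IsLinkingChain b s' c) :
    IsLinkingChain a (s ++ s') c := by
  induction h with
  | single t => exact .cons t s' c h'
  | cons t s b _ ih => exact .cons t (s ++ s') c (ih h')

/-- The link `(a, g, f)`. -/
def Link.swap {F : Type u ⥤ Type u} {X : Type u} (t : Link F X) : Link F X :=
  ⟨t.n, t.a, t.g, t.f⟩

theorem IsLinkingChain.reverse {F : Type u ⥤ Type u} {X : Type u} {a b : F.obj X}
    {s : List (Link F X)} (h : IsLinkingChain a s b) :
    IsLinkingChain b (s.map Link.swap).reverse a := by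
  induction h with
  | single t => exact .single t.swap
  | cons t s b _ ih =>
    rw [List.map_cons, List.reverse_cons]
    exact ih.append (.single t.swap)

theorem Link.cost_swap {F : Type u ⥤ Type u} {X : Type u} [PseudoEMetricSpace X] (p : ℝ≥0∞)
    (t : Link F X) : t.swap.cost p = t.cost p :=
  PiLp.edist_comm p _ _

theorem lpDist_comm_le (F : Type u ⥤ Type u) (p : ℝ≥0∞) (X : Type u) [PseudoEMetricSpace X]
    (a b : F.obj X) : lpDist F p X a b ≤ lpDist F p X b a := by
  refine le_iInf₂ fun s hs => iInf₂_le_of_le _ hs.reverse (le_of_eq ?_)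
  have h : (Link.cost p ∘ Link.swap : Link F X → ℝ≥0∞) = Link.cost p :=
    funext fun t => t.cost_swap p
  rw [List.map_reverse, List.sum_reverse, List.map_map, h]

theorem lpDist_self (F : Type u ⥤ Type u) [FiniteSupports F] (p : ℝ≥0∞) (X : Type u)
    [PseudoEMetricSpace X] (a : F.obj X) : lpDist F p X a a = 0 := by
  obtain ⟨A, hA, a', rfl⟩ := FiniteSupports.exists_finite X a
  have := hA.to_subtype
  let e : Ord.{u} (Nat.card A) ≃ A := Equiv.ulift.trans (Finite.equivFin A).symm
  let t : Link F X := ⟨Nat.card A, fmap F e.symm a', Subtype.val ∘ e, Subtype.val ∘ e⟩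
  have ht : t.src = fmap F Subtype.val a' := by
    change F.map _ (F.map _ a') = F.map _ a'
    rw [← ConcreteCategory.comp_apply, ← F.map_comp]
    have h : TypeCat.ofHom e.symm ≫ TypeCat.ofHom t.f =
        TypeCat.ofHom (Subtype.val : A → X) := by
      ext x
      exact congrArg Subtype.val (e.apply_symm_apply x)
    rw [h]
  have hc : t.cost p = 0 := PiLp.edist_self p _
  refine le_antisymm ?_ zero_le
  rw [← ht]
  refine iInf₂_le_of_le [t] (.single t) ?_
  simp [hc]

theorem lpDist_triangle (F : Type u ⥤ Type u) (p : ℝ≥0∞) (X : Type u) [PseudoEMetricSpace X]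
    (a b c : F.obj X) : lpDist F p X a c ≤ lpDist F p X a b + lpDist F p X b c := by
  unfold lpDist
  refine ENNReal.le_iInf₂_add_iInf₂ fun s hs s' hs' => ?_
  refine iInf₂_le_of_le _ (hs.append hs') ?_
  rw [List.map_append, List.sum_append]

/-- The underlying set `FX` of the distance space `F^p X = (FX, d^p_{FX})`. -/
def LpSpace (F : Type u ⥤ Type u) (_p : ℝ≥0∞) (X : Type u) : Type u := F.obj X

/-- The distance space `F^p X = (FX, d^p_{FX})`. -/
instance (F : Type u ⥤ Type u) [FiniteSupports F] (p : ℝ≥0∞) (X : Type u)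
    [PseudoEMetricSpace X] : PseudoEMetricSpace (LpSpace F p X) where
  edist := lpDist F p X
  edist_self := lpDist_self F p X
  edist_comm a b := le_antisymm (lpDist_comm_le F p X a b) (lpDist_comm_le F p X b a)
  edist_triangle := lpDist_triangle F p X

/-- The subspace `F^p_k X = {a ∈ F^p X : |supp(a)| ≤ k}` of `F^p X`. -/
abbrev LpSub (F : Type u ⥤ Type u) (p : ℝ≥0∞) (X : Type u) (k : ℕ) : Type u :=
  {a : LpSpace F p X // (supp F (X := X) a).encard ≤ k}

/-! ### Controlled dimensions -/

/-- The distance `inf {d(x,y) : x ∈ U, y ∈ V}` between two sets (`∞` if one of them is empty). -/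
def setDist {X : Type u} [PseudoEMetricSpace X] (U V : Set X) : ℝ≥0∞ :=
  ⨅ (x ∈ U) (y ∈ V), edist x y

/-- The infimum of the distances between distinct members of a family of sets. -/
def separation {X : Type u} [PseudoEMetricSpace X] (𝒰 : Set (Set X)) : ℝ≥0∞ :=
  ⨅ (U ∈ 𝒰) (V ∈ 𝒰) (_ : U ≠ V), setDist U V

/-- The supremum of the diameters of the members of a family of sets. -/
def mesh {X : Type u} [PseudoEMetricSpace X] (𝒰 : Set (Set X)) : ℝ≥0∞ :=
  ⨆ U ∈ 𝒰, Metric.ediam U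

/-- Functions from `(0,∞)` to `[0,∞]`. -/
abbrev GaugeFun : Type := Set.Ioi (0 : ℝ) → ℝ≥0∞

/-- Dimension controlling functions: non-decreasing functions from `(0,∞)` to `(0,∞]`. -/
def IsControl (D : GaugeFun) : Prop := Monotone D ∧ ∀ x, 0 < D x

/-- `dim_D X ≤ κ` for a cardinal `κ`; the families `𝒰 i` are indexed by a set of size `1 + κ`. -/
def ControlledDimLE (D : GaugeFun) (X : Type u) [PseudoEMetricSpace X]
    (κ : Cardinal.{u}) : Prop :=
  ∀ ε : Set.Ioi (0 : ℝ), ∃ 𝒰 : (1 + κ).out → Set (Set X),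
    ⋃₀ (⋃ i, 𝒰 i) = Set.univ ∧ mesh (⋃ i, 𝒰 i) ≤ D ε ∧
      ENNReal.ofReal ε ≤ ⨅ i, separation (𝒰 i)

/-- The `D`-controlled dimension `dim_D X`, a cardinal. -/
def controlledDim (D : GaugeFun) (X : Type u) [PseudoEMetricSpace X] : Cardinal.{u} :=
  sInf {κ | ControlledDimLE D X κ}

/-- The `𝒟`-controlled dimension `dim_𝒟 X = min {dim_D X : D ∈ 𝒟}`. -/
def classDim (𝒟 : Set GaugeFun) (X : Type u) [PseudoEMetricSpace X] : Cardinal.{u} :=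
  sInf ((fun D => controlledDim D X) '' 𝒟)

/-- The extension of `D : (0,∞) → [0,∞]` to `[0,∞]` by `D(0) = 0` and `D(∞) = ∞`. -/
def extend (D : GaugeFun) (y : ℝ≥0∞) : ℝ≥0∞ :=
  if h : 0 < y ∧ y < ∞ then D ⟨y.toReal, ENNReal.toReal_pos h.1.ne' h.2.ne⟩ else y

/-- Dimension controlling scales. -/
structure IsScale (𝒟 : Set GaugeFun) : Prop where
  control : ∀ f ∈ 𝒟, IsControl f
  id_mem : (fun x => ENNReal.ofReal (x : ℝ) : GaugeFun) ∈ 𝒟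
  add_mem : ∀ f ∈ 𝒟, ∀ g ∈ 𝒟, (fun x => f x + g x : GaugeFun) ∈ 𝒟
  comp_mem : ∀ f ∈ 𝒟, ∀ g ∈ 𝒟, (fun x => extend f (g x) : GaugeFun) ∈ 𝒟
  mem_of_le : ∀ f ∈ 𝒟, ∀ g, IsControl g → (∀ x, g x ≤ f x) → g ∈ 𝒟

/-- The scale of the Assouad–Nagata dimension: non-decreasing functions `f : (0,∞) → (0,∞)` with
`sup f(x)/x < ∞`. -/
def scaleAN : Set GaugeFun :=
  {f | IsControl f ∧ (∀ x, f x < ∞) ∧ ⨆ x, f x / ENNReal.ofReal x < ∞}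

/-- The scale of the asymptotic dimension: all non-decreasing functions `f : (0,∞) → (0,∞)`. -/
def scaleAS : Set GaugeFun :=
  {f | IsControl f ∧ ∀ x, f x < ∞}

/-- The scale of the uniform dimension: non-decreasing functions `f : (0,∞) → (0,∞]` with
`f(x) → 0` as `x → +0`. -/
def scaleU : Set GaugeFun :=
  {f | IsControl f ∧
    Filter.Tendsto f (Filter.comap Subtype.val (nhdsWithin (0 : ℝ) (Set.Ioi 0))) (nhds 0)}

/-- The sequence `D_k`: `D_0 = 0`, `D_1(ε) = D(n^{1-1/p} ε)` and, for `k ≥ 2`,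
with `η = 2 n N 3^{e(k)} ε` and `δ = D(η) + η`,
`D_k(ε) = (2 + 4 n N) ε + 2 k^{1/p} δ + D_{k-1}(2 ε (1 + n N) + k^{1/p} δ)`. -/
def controlSeq (p : ℝ≥0∞) (n N : ℕ) (e : ℕ → ℕ) (D : GaugeFun) : ℕ → GaugeFun
  | 0 => fun _ => 0
  | 1 => fun ε => extend D ((n : ℝ≥0∞) ^ (1 - (p⁻¹).toReal) * ENNReal.ofReal ε)
  | k + 2 => fun ε =>
      let η : ℝ≥0∞ := 2 * n * N * 3 ^ e (k + 2) * ENNReal.ofReal ε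
      let δ : ℝ≥0∞ := extend D η + η
      let c : ℝ≥0∞ := ((k + 2 : ℕ) : ℝ≥0∞) ^ (p⁻¹).toReal
      (2 + 4 * n * N) * ENNReal.ofReal ε + 2 * c * δ +
        extend (controlSeq p n N e D (k + 1)) (2 * ENNReal.ofReal ε * (1 + n * N) + c * δ)

end

end LpMetr

/-!
Families of uniformly separated, uniformly bounded subsets are encoded by partial equivalence
relations (`IsPart`), and the estimates are proved in the form of covers (`Cov`) of the
sets `suppLE F p X k` of elements whose support has at most `k` points, by induction on `k`.

*Geometry of `F^p X`.* By Hölder's inequality, a linking chain of cost `< ε` from `a` to `b` gives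
finitely many edges in `X` of total length `< n ^ (1 - 1/p) * ε`. Contracting the components of the
resulting graph gives a self-map `r` of `X` with small fibres and `Fr(a) = Fr(b)`
(`exists_retraction`). If the points of `supp a` and of `supp b` are farther apart from each other
than that, then `r` is injective on both supports, and `b` is obtained from `a` by a bijection
of supports that moves every point by a small distance (`isPart_liftRel`). Conversely, moving the
`k` points of a support by at most `M` moves the element by at most `k ^ (1/p) * M`
(`lpDist_fmap_le`). So a family of subsets of `X` induces a separated family of bounded subsets in
the part of `F^p_k X` where supports have no two close points, and an element is covered as soon as
all points of its support are covered. An element whose support has two close points is close to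
`F^p_{k-1} X`, because these two points can be merged (`exists_edist_lt_of_close`).

*Colors.* Kolmogorov's trick turns `m + 1` colors on `X` into `k * m + 1` colors, of which
every point misses at most `m`, so that any `k` points are covered by a common color
(`exists_common_color`); each added color divides the separation by `3`. If the number of colors is
infinite, then the trick is applied to the `k`-tuples of colors separately, with `m = k - 1`
(`exists_common_color_of_infinite`).

*Induction.* The cover of `F^p_{k-1} X` is thickened to cover the elements whose support has
two close points, and united with the induced cover of the remaining ones
(`IsPart.union`, `Cov.succ`). The constants add up to `controlSeq` (`cov_controlSeq`), and since
`controlSeq` is built from sums and compositions, it stays in every scale containing `D`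
(`IsScale.controlSeq_mem`).

*Degenerate cases.* Elements with empty support are at infinite distance from each other
(`cov_supp_empty`), which settles degree zero; and if `|Fn| = 0`, then `FX` is empty.
-/

namespace LpMetr

/-! ### Functoriality and supports -/

section Functor

variable {F : Type u ⥤ Type u} {X Y Z : Type u}

theorem fmap_fmap (g : Y → Z) (f : X → Y) (a : F.obj X) :
    fmap F g (fmap F f a) = fmap F (g ∘ f) a := by
  change F.map _ (F.map _ a) = F.map _ a
  rw [← ConcreteCategory.comp_apply, ← F.map_comp]
  rfl

theorem fmap_id (a : F.obj X) : fmap F id a = a := by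
  change F.map _ a = a
  have h : TypeCat.ofHom (id : X → X) = 𝟙 X := rfl
  rw [h, F.map_id]
  rfl

theorem fmap_congr_of_mem_imageOf {f g : X → Y} {a : F.obj X} {A : Set X}
    (ha : a ∈ imageOf F A) (h : Set.EqOn f g A) : fmap F f a = fmap F g a := by
  obtain ⟨b, rfl⟩ := ha
  rw [fmap_fmap, fmap_fmap]
  congr 1
  funext x
  exact h x.2

variable [FiniteSupports F]

theorem finite_supp (a : F.obj X) : (supp F a).Finite := by
  obtain ⟨A, hA, ha⟩ := FiniteSupports.exists_finite X a
  exact hA.subset (Set.sInter_subset_of_mem ha)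

/-- The value `Ff(a)` depends only on the restriction of `f` to the support of `a`, even though
`a` need not belong to `F[supp a; X]` when its support is empty. -/
theorem fmap_congr {f g : X → Y} {a : F.obj X} (h : Set.EqOn f g (supp F a)) :
    fmap F f a = fmap F g a := by
  classical
  obtain ⟨A, hA, ha⟩ := FiniteSupports.exists_finite X a
  -- The values of `f` at the points of `A` outside of the support are changed one by one.
  have key : ∀ T : Finset X, fmap F (fun x => if x ∈ T then g x else f x) a = fmap F f a := by
    intro T
    induction T using Finset.induction_on with
    | empty => simp
    | insert x T hx ih =>
      rw [← ih]
      by_cases hs : x ∈ supp F a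
      · congr 1
        funext z
        by_cases hz : z = x
        · subst hz
          simp [hx, h hs]
        · simp [hz]
      · simp only [supp, Set.mem_sInter, Set.mem_ofPred_eq, not_forall] at hs
        obtain ⟨B, hB, hxB⟩ := hs
        refine fmap_congr_of_mem_imageOf hB fun z hz => ?_
        have : z ≠ x := fun e => hxB (e ▸ hz)
        simp [this]
  rw [← key hA.toFinset]
  refine fmap_congr_of_mem_imageOf ha fun x hx => ?_
  simp [hx]

theorem fmap_eq_self {f : X → X} {a : F.obj X} (h : ∀ x ∈ supp F a, f x = x) :
    fmap F f a = a := by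
  rw [fmap_congr (g := id) h, fmap_id]

theorem mem_imageOf_supp {a : F.obj X} (h : (supp F a).Nonempty) : a ∈ imageOf F (supp F a) := by
  classical
  obtain ⟨x₀, hx₀⟩ := h
  let f : X → supp F a := fun x => if hx : x ∈ supp F a then ⟨x, hx⟩ else ⟨x₀, hx₀⟩
  refine ⟨fmap F f a, ?_⟩
  rw [fmap_fmap]
  refine fmap_eq_self fun x hx => ?_
  simp [f, hx]

/-- For maps between different sets this fails: if `FX` is a point for `X ≠ ∅` and
empty for `X = ∅`, then the element of `FX` has empty support when `X` has at
least two points, but not when `X` is a singleton. -/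
theorem supp_fmap_subset (f : X → X) (a : F.obj X) : supp F (fmap F f a) ⊆ f '' supp F a := by
  rcases (supp F a).eq_empty_or_nonempty with h | h
  · rw [fmap_eq_self (f := f) (by simp [h]), h]
    simp
  · obtain ⟨b, hb⟩ := mem_imageOf_supp h
    refine Set.sInter_subset_of_mem ?_
    let f' : supp F a → f '' supp F a := fun x => ⟨f x, x, x.2, rfl⟩
    refine ⟨fmap F f' b, ?_⟩
    have h' := congrArg (fmap F f) hb
    rw [fmap_fmap] at h' ⊢
    exact h'

theorem exists_leftInverse_on {f : X → X} {A : Set X} (h : Set.InjOn f A) :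
    ∃ g : X → X, ∀ x ∈ A, g (f x) = x := by
  rcases isEmpty_or_nonempty X with hX | hX
  · exact ⟨id, fun x => (hX.false x).elim⟩
  · exact ⟨Function.invFunOn f A, fun x hx => h.leftInvOn_invFunOn hx⟩

theorem supp_fmap_of_injOn {f : X → X} {a : F.obj X} (h : Set.InjOn f (supp F a)) :
    supp F (fmap F f a) = f '' supp F a := by
  refine (supp_fmap_subset f a).antisymm ?_
  obtain ⟨g, hg⟩ := exists_leftInverse_on h
  rintro _ ⟨x, hx, rfl⟩
  have ha : a = fmap F g (fmap F f a) := by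
    rw [fmap_fmap]
    exact (fmap_eq_self hg).symm
  have hx' := hx
  rw [ha] at hx'
  obtain ⟨y, hy, rfl⟩ := supp_fmap_subset g _ hx'
  obtain ⟨z, hz, rfl⟩ := supp_fmap_subset f _ hy
  rwa [hg z hz]

end Functor

/-! ### Short linking chains give retractions with small fibres -/

section Chains

variable {F : Type u ⥤ Type u} {X : Type u}

/-- Contracting the connected components of the graph with finitely many given edges: points of
one component are joined by a path without repeated edges, so their distance is at most the
sum of the lengths of all edges. -/
theorem exists_contraction [PseudoEMetricSpace X] (l : List (X × X)) :
    ∃ r : X → X, (∀ e ∈ l, r e.1 = r e.2) ∧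
      ∀ x y, r x = r y → edist x y ≤ (l.map fun e => edist e.1 e.2).sum := by
  classical
  let len : Sym2 X → ℝ≥0∞ := Sym2.lift ⟨fun x y => edist x y, fun x y => edist_comm x y⟩
  let S : Finset (Sym2 X) := (l.map fun e => s(e.1, e.2)).toFinset
  let G : SimpleGraph X := SimpleGraph.fromEdgeSet (S : Set (Sym2 X))
  have hwalk : ∀ {x y : X} (w : G.Walk x y), edist x y ≤ (w.edges.map len).sum := by
    intro x y w
    induction w with
    | nil => simp
    | @cons x y z h w ih =>
      rw [SimpleGraph.Walk.edges_cons, List.map_cons, List.sum_cons]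
      exact (edist_triangle x y z).trans (add_le_add le_rfl ih)
  have hS : ∑ e ∈ S, len e ≤ (l.map fun e => edist e.1 e.2).sum := by
    have : ∀ l : List (X × X), ∑ e ∈ (l.map fun e => s(e.1, e.2)).toFinset, len e ≤
        (l.map fun e => edist e.1 e.2).sum := by
      intro l
      induction l with
      | nil => simp
      | cons e l ih =>
        simp only [List.map_cons, List.toFinset_cons, List.sum_cons]
        refine le_trans ?_ (add_le_add le_rfl ih)
        by_cases he : s(e.1, e.2) ∈ (l.map fun e => s(e.1, e.2)).toFinset
        · rw [Finset.insert_eq_of_mem he]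
          exact le_add_self
        · rw [Finset.sum_insert he]
          rfl
    exact this l
  refine ⟨fun x => (G.connectedComponentMk x).out, fun e he => ?_, fun x y hxy => ?_⟩
  · refine congrArg Quot.out (SimpleGraph.ConnectedComponent.eq.2 ?_)
    by_cases h : e.1 = e.2
    · rw [h]
    · refine SimpleGraph.Adj.reachable ?_
      rw [SimpleGraph.fromEdgeSet_adj]
      refine ⟨?_, h⟩
      simp only [S, Finset.mem_coe, List.mem_toFinset, List.mem_map]
      exact ⟨e, he, rfl⟩
  · have h : G.connectedComponentMk x = G.connectedComponentMk y := by
      have := congrArg G.connectedComponentMk hxy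
      simpa [SimpleGraph.connectedComponentMk] using this
    obtain ⟨w⟩ := SimpleGraph.ConnectedComponent.exact h
    refine (hwalk w.bypass).trans (le_trans ?_ hS)
    have hnd := w.bypass_isPath.isTrail.edges_nodup
    rw [← List.sum_toFinset _ hnd]
    refine Finset.sum_le_sum_of_subset fun e he => ?_
    have := w.bypass.edges_subset_edgeSet (List.mem_toFinset.1 he)
    rw [SimpleGraph.edgeSet_fromEdgeSet] at this
    exact Finset.mem_coe.1 this.1

/-- Hölder's inequality: the `ℓ^1`-length of a link over the support of its element is
controlled by its `ℓ^p`-length. -/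
theorem sum_edist_le_cost [PseudoEMetricSpace X] {p : ℝ≥0∞} (hp : 1 ≤ p) (t : Link F X) {n : ℕ}
    (A : Finset (Ord.{u} t.n)) (hA : A.card ≤ n) :
    ∑ j ∈ A, edist (t.f j) (t.g j) ≤ (n : ℝ≥0∞) ^ (1 - (p⁻¹).toReal) * t.cost p := by
  rcases eq_or_ne p ∞ with rfl | hp'
  · have h : ∀ j ∈ A, edist (t.f j) (t.g j) ≤ t.cost ∞ := fun j _ => by
      rw [Link.cost, PiLp.edist_eq_iSup]
      exact le_iSup (fun j => edist (t.f j) (t.g j)) j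
    refine (Finset.sum_le_card_nsmul _ _ _ h).trans ?_
    simp only [nsmul_eq_mul, ENNReal.inv_top, ENNReal.toReal_zero, sub_zero, ENNReal.rpow_one]
    gcongr
  · have hp1 : 1 ≤ p.toReal := by
      simpa using ENNReal.toReal_mono hp' hp
    have hp0 : 0 < p.toReal := zero_lt_one.trans_le hp1
    have h1 := ENNReal.rpow_sum_le_const_mul_sum_rpow A (fun j => edist (t.f j) (t.g j)) hp1
    have h2 : (∑ j ∈ A, edist (t.f j) (t.g j) ^ p.toReal) ^ (1 / p.toReal) ≤ t.cost p := by
      rw [Link.cost, PiLp.edist_eq_sum hp0]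
      gcongr
      exact A.subset_univ
    have h3 := ENNReal.rpow_le_rpow h1 (one_div_nonneg.2 hp0.le)
    rw [← ENNReal.rpow_mul, mul_one_div_cancel hp0.ne', ENNReal.rpow_one,
      ENNReal.mul_rpow_of_nonneg _ _ (one_div_nonneg.2 hp0.le), ← ENNReal.rpow_mul] at h3
    refine h3.trans ?_
    have e : (p.toReal - 1) * (1 / p.toReal) = 1 - (p⁻¹).toReal := by
      rw [ENNReal.toReal_inv]
      field_simp
    rw [e]
    refine mul_le_mul' (ENNReal.rpow_le_rpow (by exact_mod_cast hA) ?_) h2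
    rw [ENNReal.toReal_inv]
    exact sub_nonneg.2 (inv_le_one_of_one_le₀ hp1)

variable [FiniteSupports F]

theorem IsLinkingChain.fmap_eq {a b : F.obj X} {s : List (Link F X)} (h : IsLinkingChain a s b)
    {r : X → X} (hr : ∀ t ∈ s, ∀ j ∈ supp F t.a, r (t.f j) = r (t.g j)) :
    fmap F r a = fmap F r b := by
  have hlink : ∀ t : Link F X, (∀ j ∈ supp F t.a, r (t.f j) = r (t.g j)) →
      fmap F r t.src = fmap F r t.tgt := by
    intro t ht
    rw [Link.src, Link.tgt, fmap_fmap, fmap_fmap]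
    exact fmap_congr ht
  induction h with
  | single t => exact hlink t (hr t (by simp))
  | cons t s b _ ih =>
    exact (hlink t (hr t (by simp))).trans (ih fun t' ht' => hr t' (by simp [ht']))

/-- If `a` and `b` are at distance less than `ε`, then a self-map of `X` with fibres of diameter
less than `n ^ (1 - 1/p) * ε` identifies `a` with `b`: it contracts the connected components of the
graph whose edges join `f j` and `g j` over the links `(a, f, g)` of a short chain. -/
theorem exists_retraction [PseudoEMetricSpace X] {p : ℝ≥0∞} (hp : 1 ≤ p) {n : ℕ} (hn : 1 ≤ n)
    (hdeg : HasDegreeLE F n) {a b : F.obj X} {ε : ℝ≥0∞} (h : lpDist F p X a b < ε) :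
    ∃ r : X → X, fmap F r a = fmap F r b ∧
      ∀ x y, r x = r y → edist x y < (n : ℝ≥0∞) ^ (1 - (p⁻¹).toReal) * ε := by
  obtain ⟨s, h'⟩ := iInf_lt_iff.1 h
  obtain ⟨hs, hc⟩ := iInf_lt_iff.1 h'
  let A : (t : Link F X) → Finset (Ord.{u} t.n) := fun t => (finite_supp t.a).toFinset
  have hA : ∀ t, (A t).card ≤ n := fun t => by
    have := hdeg _ t.a
    rw [(finite_supp t.a).encard_eq_coe_toFinset_card] at this
    exact_mod_cast this
  let l : List (X × X) := s.flatMap fun t => (A t).toList.map fun j => (t.f j, t.g j)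
  obtain ⟨r, hr, hd⟩ := exists_contraction l
  refine ⟨r, hs.fmap_eq fun t ht j hj => ?_, fun x y hxy => (hd x y hxy).trans_lt ?_⟩
  · refine hr (t.f j, t.g j) ?_
    simp only [l, List.mem_flatMap, List.mem_map, Finset.mem_toList]
    exact ⟨t, ht, j, by simpa [A] using hj, rfl⟩
  · have hn0 : (n : ℝ≥0∞) ^ (1 - (p⁻¹).toReal) ≠ 0 := by
      have : (n : ℝ≥0∞) ≠ 0 := by positivity
      simp [ENNReal.rpow_eq_zero_iff, this]
    have hn1 : (n : ℝ≥0∞) ^ (1 - (p⁻¹).toReal) ≠ ∞ := by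
      have : (n : ℝ≥0∞) ≠ 0 := by positivity
      simp [ENNReal.rpow_eq_top_iff, this]
    refine lt_of_le_of_lt ?_ (ENNReal.mul_lt_mul_right hn0 hn1 hc)
    clear h' hs hc hr hd
    induction s with
    | nil => simp [l]
    | cons t s ih =>
      have : (((A t).toList.map fun j => (t.f j, t.g j)).map fun e => edist e.1 e.2).sum ≤
          (n : ℝ≥0∞) ^ (1 - (p⁻¹).toReal) * t.cost p := by
        refine le_trans (le_of_eq ?_) (sum_edist_le_cost hp t (A t) (hA t))
        rw [List.map_map, Finset.sum_map_toList]
        rfl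
      simp only [l, List.flatMap_cons, List.map_append, List.sum_append, List.map_cons,
        List.sum_cons, mul_add]
      exact add_le_add this ih

/-! ### Upper bounds for the distance -/

/-- Moving the support of `a` by `τ` gives a single link from `a` to `Fτ(a)`. -/
theorem exists_link (a : F.obj X) (h : (supp F a).Nonempty) (τ : X → X) :
    ∃ t : Link F X, t.src = a ∧ t.tgt = fmap F τ a ∧ (∀ j, t.f j ∈ supp F a) ∧
      (∀ j, t.g j = τ (t.f j)) ∧ Function.Injective t.f ∧ (t.n : ℕ∞) = (supp F a).encard := by
  obtain ⟨b, hb⟩ := mem_imageOf_supp h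
  have hfin := finite_supp a
  have := hfin.to_subtype
  let e : Ord.{u} (Nat.card (supp F a)) ≃ supp F a :=
    Equiv.ulift.trans (Finite.equivFin (supp F a)).symm
  refine ⟨⟨Nat.card (supp F a), fmap F e.symm b, Subtype.val ∘ e, τ ∘ Subtype.val ∘ e⟩,
    ?_, ?_, fun j => (e j).2, fun j => rfl, Subtype.val_injective.comp e.injective, ?_⟩
  · rw [Link.src, fmap_fmap, Function.comp_assoc, e.self_comp_symm]
    exact hb
  · conv_rhs => rw [← hb, fmap_fmap]
    rw [Link.tgt, fmap_fmap, Function.comp_assoc, Function.comp_assoc, e.self_comp_symm]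
    rfl
  · exact hfin.cast_ncard_eq

omit [FiniteSupports F] in
theorem lpDist_le_cost [PseudoEMetricSpace X] (p : ℝ≥0∞) (t : Link F X) :
    lpDist F p X t.src t.tgt ≤ t.cost p := by
  refine iInf₂_le_of_le [t] (.single t) ?_
  simp

theorem lpDist_fmap_le [PseudoEMetricSpace X] {p : ℝ≥0∞} (hp : 1 ≤ p) {a : F.obj X} {k : ℕ}
    (hk : (supp F a).encard ≤ k) {τ : X → X} {M : ℝ≥0∞}
    (hτ : ∀ x ∈ supp F a, edist x (τ x) ≤ M) :
    lpDist F p X a (fmap F τ a) ≤ (k : ℝ≥0∞) ^ (p⁻¹).toReal * M := by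
  rcases (supp F a).eq_empty_or_nonempty with h | h
  · rw [fmap_eq_self (by simp [h]), lpDist_self]
    exact zero_le
  obtain ⟨t, hs, ht, hf, hg, -, hcard⟩ := exists_link a h τ
  have hkn : t.n ≤ k := by
    rw [← hcard] at hk
    exact_mod_cast hk
  rw [← ht]
  conv_lhs => rw [← hs]
  refine (lpDist_le_cost p t).trans ?_
  have hd : ∀ j, edist (t.f j) (t.g j) ≤ M := fun j => hg j ▸ hτ _ (hf j)
  rcases eq_or_ne p ∞ with rfl | hp'
  · rw [Link.cost, PiLp.edist_eq_iSup]
    simpa using hd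
  · have hp0 : 0 < p.toReal := ENNReal.toReal_pos (zero_lt_one.trans_le hp).ne' hp'
    rw [Link.cost, PiLp.edist_eq_sum hp0, ENNReal.toReal_inv]
    have h1 : ∑ j, edist (t.f j) (t.g j) ^ p.toReal ≤ (k : ℝ≥0∞) * M ^ p.toReal := by
      refine (Finset.sum_le_card_nsmul _ _ (M ^ p.toReal) fun j _ => by gcongr; exact hd j).trans ?_
      simp only [nsmul_eq_mul]
      gcongr
      simpa using hkn
    refine (ENNReal.rpow_le_rpow h1 (one_div_nonneg.2 hp0.le)).trans (le_of_eq ?_)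
    rw [ENNReal.mul_rpow_of_nonneg _ _ (one_div_nonneg.2 hp0.le), ← ENNReal.rpow_mul,
      mul_one_div_cancel hp0.ne', ENNReal.rpow_one, one_div]

theorem lpDist_fmap_update_le [PseudoEMetricSpace X] [DecidableEq X] {p : ℝ≥0∞} (hp : 1 ≤ p)
    {a : F.obj X} {x y : X} (hx : x ∈ supp F a) :
    lpDist F p X a (fmap F (Function.update id x y) a) ≤ edist x y := by
  obtain ⟨t, hs, ht, hf, hg, hinj, -⟩ := exists_link a ⟨x, hx⟩ (Function.update id x y)
  rw [← ht]
  conv_lhs => rw [← hs]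
  refine (lpDist_le_cost p t).trans ?_
  have h0 : ∀ j, t.f j ≠ x → edist (t.f j) (t.g j) = 0 := fun j hj => by
    rw [hg, Function.update_of_ne hj, id, edist_self]
  have h1 : ∀ j, t.f j = x → edist (t.f j) (t.g j) = edist x y := fun j hj => by
    rw [hg, hj, Function.update_self]
  rcases eq_or_ne p ∞ with rfl | hp'
  · rw [Link.cost, PiLp.edist_eq_iSup]
    refine iSup_le fun j => ?_
    change edist (t.f j) (t.g j) ≤ _
    by_cases hj : t.f j = x
    · rw [h1 j hj]
    · rw [h0 j hj]
      exact zero_le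
  · have hp0 : 0 < p.toReal := ENNReal.toReal_pos (zero_lt_one.trans_le hp).ne' hp'
    rw [Link.cost, PiLp.edist_eq_sum hp0]
    have h2 : ∑ j, edist (t.f j) (t.g j) ^ p.toReal ≤ edist x y ^ p.toReal := by
      by_cases hj : ∃ j, t.f j = x
      · obtain ⟨j, hj⟩ := hj
        rw [Finset.sum_eq_single j, h1 j hj]
        · intro i _ hi
          rw [h0 i fun e => hi (hinj (e.trans hj.symm)), ENNReal.zero_rpow_of_pos hp0]
        · simp
      · push Not at hj
        rw [Finset.sum_eq_zero]
        · exact zero_le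
        · intro i _
          rw [h0 i (hj i), ENNReal.zero_rpow_of_pos hp0]
    refine (ENNReal.rpow_le_rpow h2 (one_div_nonneg.2 hp0.le)).trans (le_of_eq ?_)
    rw [← ENNReal.rpow_mul, mul_one_div_cancel hp0.ne', ENNReal.rpow_one]

end Chains

/-! ### Separated families of bounded sets as partial equivalence relations -/

/-- A family of pairwise disjoint subsets of `Z`, encoded by the partial equivalence relation
"`x` and `y` belong to a common member" (so `R x x` says that `x` is covered), whose
members have diameter `≤ M` and pairwise distances `≥ ε`. -/
structure IsPart {Z : Type*} [PseudoEMetricSpace Z] (R : Z → Z → Prop) (ε M : ℝ≥0∞) : Prop where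
  symm : ∀ {x y}, R x y → R y x
  trans : ∀ {x y z}, R x y → R y z → R x z
  sep : ∀ {x y}, R x x → R y y → edist x y < ε → R x y
  mesh : ∀ {x y}, R x y → edist x y ≤ M

/-- The set `A` is covered by families of sets of diameter `≤ M`, indexed by the "colors" `i : I`,
such that distinct sets of the same color are at distance `≥ ε`. -/
def Cov {Z : Type*} [PseudoEMetricSpace Z] (A : Set Z) (I : Type*) (ε M : ℝ≥0∞) : Prop :=
  ∃ R : I → Z → Z → Prop, (∀ i, IsPart (R i) ε M) ∧ ∀ x ∈ A, ∃ i, R i x x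

section Part

variable {Z : Type*} [PseudoEMetricSpace Z] {R : Z → Z → Prop} {ε M : ℝ≥0∞}

theorem IsPart.left (h : IsPart R ε M) {x y : Z} (hxy : R x y) : R x x :=
  h.trans hxy (h.symm hxy)

theorem IsPart.right (h : IsPart R ε M) {x y : Z} (hxy : R x y) : R y y :=
  h.trans (h.symm hxy) hxy

theorem IsPart.mono (h : IsPart R ε M) {ε' M' : ℝ≥0∞} (hε : ε' ≤ ε) (hM : M ≤ M') :
    IsPart R ε' M' :=
  ⟨h.symm, h.trans, fun hx hy hd => h.sep hx hy (hd.trans_le hε), fun hxy => (h.mesh hxy).trans hM⟩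

theorem isPart_false : IsPart (fun _ _ : Z => False) ε M :=
  ⟨id, fun h _ => h, fun h _ _ => h, False.elim⟩

theorem IsPart.comap {Y : Type*} [PseudoEMetricSpace Y] (h : IsPart R ε M) {f : Y → Z}
    (hf : Isometry f) : IsPart (fun x y => R (f x) (f y)) ε M :=
  ⟨h.symm, h.trans, fun hx hy hd => h.sep hx hy (by rwa [hf.edist_eq]), fun hxy => by
    rw [← hf.edist_eq]
    exact h.mesh hxy⟩

/-- The members of a family are replaced by their open `r`-neighborhoods. -/
def thicken (R : Z → Z → Prop) (r : ℝ≥0∞) (x y : Z) : Prop :=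
  ∃ u v, edist x u < r ∧ R u v ∧ edist v y < r

theorem IsPart.thicken {r : ℝ≥0∞} (h : IsPart R (ε + 2 * r) M) :
    IsPart (thicken R r) ε (M + 2 * r) where
  symm := by
    rintro x y ⟨u, v, hu, hR, hv⟩
    exact ⟨v, u, by rwa [edist_comm], h.symm hR, by rwa [edist_comm]⟩
  trans := by
    rintro x y z ⟨u, v, hu, hR, hv⟩ ⟨u', v', hu', hR', hv'⟩
    refine ⟨u, v', hu, h.trans hR (h.trans (h.sep (h.right hR) (h.left hR') ?_) hR'), hv'⟩
    calc edist v u' ≤ edist v y + edist y u' := edist_triangle _ _ _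
      _ < r + r := ENNReal.add_lt_add hv hu'
      _ ≤ ε + 2 * r := by rw [← two_mul]; exact le_add_self
  sep := by
    rintro x y ⟨u, v, hu, hR, -⟩ ⟨u', v', hu', hR', hv'⟩ hd
    refine ⟨u, v', hu, h.trans (h.sep (h.left hR) (h.left hR') ?_) hR', hv'⟩
    calc edist u u' ≤ edist u x + edist x y + edist y u' := edist_triangle4 _ _ _ _
      _ < r + ε + r := ENNReal.add_lt_add (ENNReal.add_lt_add (by rwa [edist_comm]) hd) hu'
      _ = ε + 2 * r := by ring
  mesh := by
    rintro x y ⟨u, v, hu, hR, hv⟩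
    calc edist x y ≤ edist x u + edist u v + edist v y := edist_triangle4 _ _ _ _
      _ ≤ r + M + r := by gcongr; exact h.mesh hR
      _ = M + 2 * r := by ring

theorem subset_thicken {r : ℝ≥0∞} (hr : 0 < r) {x y : Z} (h : R x y) : thicken R r x y :=
  ⟨x, y, by simpa using hr, h, by simpa using hr⟩

/-- The saturated union of two families `P` and `Q`: every member `U` of `P` is
enlarged by the members of `Q` at distance less than `ε` from `U`, and the members of `Q`
which are not near `P` are kept. -/
theorem IsPart.union {P Q : Z → Z → Prop} (hε : 0 < ε) {r : ℝ≥0∞} (hr : r ≠ ∞)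
    (hP : IsPart P (2 * ε + r) M) (hQ : IsPart Q ε r) :
    ∃ T : Z → Z → Prop, IsPart T ε (M + 2 * ε + 2 * r) ∧ ∀ x, P x x ∨ Q x x → T x x := by
  -- `N x u` says that `x` is equal to `u` or belongs to a member of `Q` which is near `u`
  let N : Z → Z → Prop := fun x u => x = u ∨ ∃ z, Q x z ∧ edist z u < ε
  have hN : ∀ {x u}, N x u → edist x u ≤ r + ε := by
    rintro x u (rfl | ⟨z, hz, hd⟩)
    · simp
    · exact (edist_triangle x z u).trans (add_le_add (hQ.mesh hz) hd.le)
  have hrε : r + ε + ε = 2 * ε + r := by ring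
  have hPQ : ∀ {x u z v}, edist u x < ε → Q x z → edist z v < ε → edist u v < 2 * ε + r := by
    intro x u z v h1 h2 h3
    calc edist u v ≤ edist u x + edist x z + edist z v := edist_triangle4 _ _ _ _
      _ ≤ edist u x + r + edist z v := by gcongr; exact hQ.mesh h2
      _ < ε + r + ε := ENNReal.add_lt_add (ENNReal.add_lt_add_right hr h1) h3
      _ = 2 * ε + r := by ring
  have hself : ∀ u : Z, edist u u < ε := fun u => by simpa using hε
  -- If `x` and `y` are close, then so are the members of `P` to which they are attached.
  have hNN : ∀ {x y u v}, P u u → P v v → N x u → N y v → Q x y ∨ edist x y < ε → P u v := by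
    rintro x y u v hu hv (rfl | ⟨z, hz, hd⟩) (rfl | ⟨z', hz', hd'⟩) hxy <;>
      refine hP.sep hu hv ?_
    · rcases hxy with h | h
      · exact hPQ (hself _) h (hself _)
      · exact h.trans_le (by rw [two_mul, add_assoc]; exact le_self_add)
    · rcases hxy with h | h
      · exact hPQ (hself _) (hQ.trans h hz') hd'
      · exact hPQ h hz' hd'
    · rcases hxy with h | h
      · rw [edist_comm]
        exact hPQ (hself _) (hQ.trans (hQ.symm h) hz) hd
      · rw [edist_comm] at h ⊢
        exact hPQ h hz hd
    · rw [edist_comm] at hd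
      have : Q x y := by
        rcases hxy with h | h
        · exact h
        · exact hQ.sep (hQ.left hz) (hQ.left hz') h
      exact hPQ hd (hQ.trans (hQ.symm hz) (hQ.trans this hz')) hd'
  have hNx : ∀ {x u v}, P u u → P v v → N x u → N x v → P u v := fun hu hv h h' =>
    hNN hu hv h h' (Or.inr (hself _))
  -- Being near `P` is a property of members of `Q`.
  have hnear : ∀ {x y}, Q x y → (∃ u, P u u ∧ N y u) → ∃ u, P u u ∧ N x u := by
    rintro x y hxy ⟨u, hu, rfl | ⟨z, hz, hd⟩⟩
    · exact ⟨y, hu, Or.inr ⟨y, hxy, hself _⟩⟩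
    · exact ⟨u, hu, Or.inr ⟨z, hQ.trans hxy hz, hd⟩⟩
  refine ⟨fun x y => (∃ u v, N x u ∧ P u v ∧ N y v) ∨ (Q x y ∧ ¬ ∃ u, P u u ∧ N x u),
    ⟨?_, ?_, ?_, ?_⟩, ?_⟩
  · rintro x y (⟨u, v, h1, h2, h3⟩ | ⟨h1, h2⟩)
    · exact Or.inl ⟨v, u, h3, hP.symm h2, h1⟩
    · exact Or.inr ⟨hQ.symm h1, fun h => h2 (hnear h1 h)⟩
  · rintro x y z (⟨u, v, h1, h2, h3⟩ | ⟨h1, h2⟩) (⟨u', v', h1', h2', h3'⟩ | ⟨h1', h2'⟩)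
    · exact Or.inl ⟨u, v', h1, hP.trans h2
        (hP.trans (hNx (hP.right h2) (hP.left h2') h3 h1') h2'), h3'⟩
    · exact (h2' ⟨v, hP.right h2, h3⟩).elim
    · exact (h2 (hnear h1 ⟨u', hP.left h2', h1'⟩)).elim
    · exact Or.inr ⟨hQ.trans h1 h1', h2⟩
  · rintro x y (⟨u, v, h1, h2, h3⟩ | ⟨h1, h2⟩) (⟨u', v', h1', h2', h3'⟩ | ⟨h1', h2'⟩) hd
    · exact Or.inl ⟨u, u', h1, hNN (hP.left h2) (hP.left h2') h1 h1' (Or.inr hd), h1'⟩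
    · rcases h1 with rfl | ⟨z, hz, hd'⟩
      · exact (h2' ⟨x, hP.left h2, Or.inr ⟨y, h1', by rwa [edist_comm]⟩⟩).elim
      · exact (h2' (hnear (hQ.symm (hQ.sep (hQ.left hz) h1' hd))
          ⟨u, hP.left h2, Or.inr ⟨z, hz, hd'⟩⟩)).elim
    · rcases h1' with rfl | ⟨z, hz, hd'⟩
      · exact (h2 ⟨y, hP.left h2', Or.inr ⟨x, h1, hd⟩⟩).elim
      · exact (h2 (hnear (hQ.sep h1 (hQ.left hz) hd)
          ⟨u', hP.left h2', Or.inr ⟨z, hz, hd'⟩⟩)).elim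
    · exact Or.inr ⟨hQ.sep h1 h1' hd, h2⟩
  · rintro x y (⟨u, v, h1, h2, h3⟩ | ⟨h1, h2⟩)
    · calc edist x y ≤ edist x u + edist u v + edist v y := edist_triangle4 _ _ _ _
        _ ≤ (r + ε) + M + (r + ε) := by
          gcongr
          · exact hN h1
          · exact hP.mesh h2
          · rw [edist_comm]
            exact hN h3
        _ = M + 2 * ε + 2 * r := by ring
    · refine (hQ.mesh h1).trans ?_
      rw [two_mul r, ← add_assoc]
      exact le_add_self
  · intro x hx
    by_cases h : ∃ u, P u u ∧ N x u
    · obtain ⟨u, hu, hxu⟩ := h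
      exact Or.inl ⟨u, u, hxu, hu, hxu⟩
    · rcases hx with hx | hx
      · exact (h ⟨x, hx, Or.inl rfl⟩).elim
      · exact Or.inr ⟨hx, h⟩

/-! ### Covers -/

variable {A B : Set Z} {I J : Type*}

theorem Cov.mono (h : Cov A I ε M) {ε' M' : ℝ≥0∞} (hBA : B ⊆ A) (hε : ε' ≤ ε) (hM : M ≤ M') :
    Cov B I ε' M' := by
  obtain ⟨R, hR, hA⟩ := h
  exact ⟨R, fun i => (hR i).mono hε hM, fun x hx => hA x (hBA hx)⟩

theorem Cov.embed (h : Cov A I ε M) (f : I ↪ J) : Cov A J ε M := by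
  obtain ⟨R, hR, hA⟩ := h
  refine ⟨fun j x y => ∃ i, f i = j ∧ R i x y, fun j => ?_, fun x hx => ?_⟩
  · by_cases hj : ∃ i, f i = j
    · obtain ⟨i, rfl⟩ := hj
      have : (fun x y => ∃ i', f i' = f i ∧ R i' x y) = R i := by
        funext x y
        simp
      beta_reduce
      rw [this]
      exact hR i
    · have : (fun x y => ∃ i, f i = j ∧ R i x y) = fun _ _ => False := by
        funext x y
        simp only [eq_iff_iff, iff_false]
        exact fun ⟨i, hi, _⟩ => hj ⟨i, hi⟩
      beta_reduce
      rw [this]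
      exact isPart_false
  · obtain ⟨i, hi⟩ := hA x hx
    exact ⟨f i, i, rfl, hi⟩

theorem cov_top [Nonempty I] : Cov A I ε ∞ :=
  ⟨fun _ _ _ => True, fun _ => ⟨fun _ => trivial, fun _ _ => trivial, fun _ _ _ => trivial,
    fun _ => le_top⟩, fun _ _ => ⟨Classical.arbitrary I, trivial⟩⟩

theorem Cov.thicken {r : ℝ≥0∞} (h : Cov A I (ε + 2 * r) M)
    (hB : ∀ x ∈ B, ∃ y ∈ A, edist x y < r) : Cov B I ε (M + 2 * r) := by
  obtain ⟨R, hR, hA⟩ := h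
  refine ⟨fun i => LpMetr.thicken (R i) r, fun i => (hR i).thicken, fun x hx => ?_⟩
  obtain ⟨y, hy, hd⟩ := hB x hx
  obtain ⟨i, hi⟩ := hA y hy
  exact ⟨i, y, y, hd, hi, by rwa [edist_comm]⟩

theorem Cov.union (hε : 0 < ε) {r : ℝ≥0∞} (hr : r ≠ ∞) (hA : Cov A I (2 * ε + r) M)
    (hB : Cov B I ε r) : Cov (A ∪ B) I ε (M + 2 * ε + 2 * r) := by
  obtain ⟨P, hP, hA⟩ := hA
  obtain ⟨Q, hQ, hB⟩ := hB
  choose T hT hTx using fun i => (hP i).union hε hr (hQ i)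
  refine ⟨T, hT, fun x hx => ?_⟩
  rcases hx with hx | hx
  · obtain ⟨i, hi⟩ := hA x hx
    exact ⟨i, hTx i x (Or.inl hi)⟩
  · obtain ⟨i, hi⟩ := hB x hx
    exact ⟨i, hTx i x (Or.inr hi)⟩

end Part

/-! ### Kolmogorov's trick: adding colors -/

section Kolmogorov

variable {Z : Type*} [PseudoEMetricSpace Z] {Y : Set Z} {m : ℕ} {M s : ℝ≥0∞}

/-- One more color is added such that every point of `Y` is still missed by at most `m` colors.
The given families are thickened, and the new family covers the points which
the thickening does not attach to a new color. -/
theorem exists_add_color {ι : Type} [Fintype ι] (hs : 0 < s) (hm : m < Fintype.card ι)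
    {R : ι → Z → Z → Prop} (hR : ∀ i, IsPart (R i) (3 * s) M)
    (hY : ∀ x ∈ Y, {i | ¬ R i x x}.ncard ≤ m) :
    ∃ R' : Option ι → Z → Z → Prop, (∀ i, IsPart (R' i) s (M + 2 * s)) ∧
      ∀ x ∈ Y, {i | ¬ R' i x x}.ncard ≤ m := by
  have hR3 : ∀ i, IsPart (R i) (s + 2 * s) M := fun i => by
    have : s + 2 * s = 3 * s := by ring
    rw [this]
    exact hR i
  have hs3 : s ≤ 3 * s := le_mul_of_one_le_left' (by norm_num)
  let bad : Z → Prop := fun x => (∀ i, thicken (R i) s x x → R i x x) ∧ ∃ i, R i x x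
  let S : Z → Z → Prop := fun x y => bad x ∧ bad y ∧ ∀ i, R i x x ∨ R i y y → R i x y
  have hS : IsPart S s (M + 2 * s) := by
    refine ⟨?_, ?_, ?_, ?_⟩
    · rintro x y ⟨hx, hy, h⟩
      exact ⟨hy, hx, fun i hi => (hR i).symm (h i hi.symm)⟩
    · rintro x y z ⟨hx, hy, h⟩ ⟨-, hz, h'⟩
      refine ⟨hx, hz, fun i hi => ?_⟩
      rcases hi with hi | hi
      · have := h i (Or.inl hi)
        exact (hR i).trans this (h' i (Or.inl ((hR i).right this)))
      · have := h' i (Or.inr hi)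
        exact (hR i).trans (h i (Or.inr ((hR i).left this))) this
    · rintro x y ⟨hx, -, -⟩ ⟨hy, -, -⟩ hd
      refine ⟨hx, hy, fun i hi => ?_⟩
      rcases hi with hi | hi
      · exact (hR i).sep hi (hy.1 i ⟨x, x, by rwa [edist_comm], hi, hd⟩) (hd.trans_le hs3)
      · exact (hR i).sep (hx.1 i ⟨y, y, hd, hi, by rwa [edist_comm]⟩) hi (hd.trans_le hs3)
    · rintro x y ⟨hx, -, h⟩
      obtain ⟨i, hi⟩ := hx.2
      exact ((hR i).mesh (h i (Or.inl hi))).trans le_self_add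
  refine ⟨fun o => o.elim S fun i => thicken (R i) s, ?_, fun x hx => ?_⟩
  · rintro (_ | i)
    · exact hS
    · exact (hR3 i).thicken
  · have hsub : {i | ¬ thicken (R i) s x x} ⊆ {i | ¬ R i x x} := fun i hi h =>
      hi (subset_thicken hs h)
    have hmiss := hY x hx
    by_cases hb : bad x
    · have : {o : Option ι | ¬ (o.elim S fun i => thicken (R i) s) x x} ⊆
          some '' {i | ¬ R i x x} := by
        rintro (_ | i) hi
        · exact (hi ⟨hb, hb, fun i hi => hi.elim id id⟩).elim
        · exact ⟨i, hsub hi, rfl⟩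
      exact (Set.ncard_le_ncard this).trans ((Set.ncard_image_le).trans hmiss)
    · have hex : ∃ i, R i x x := by
        by_contra! h
        have : {i | ¬ R i x x} = Set.univ := Set.eq_univ_of_forall h
        rw [this, Set.ncard_univ, Nat.card_eq_fintype_card] at hmiss
        omega
      have hlt : {i | ¬ thicken (R i) s x x} ⊂ {i | ¬ R i x x} := by
        refine hsub.ssubset_of_ne fun he => hb ⟨fun i hi => ?_, hex⟩
        by_contra hn
        have : i ∈ {i | ¬ thicken (R i) s x x} := by
          rw [he]
          exact hn
        exact this hi
      have : {o : Option ι | ¬ (o.elim S fun i => thicken (R i) s) x x} ⊆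
          insert none (some '' {i | ¬ thicken (R i) s x x}) := by
        rintro (_ | i) hi
        · exact Or.inl rfl
        · exact Or.inr ⟨i, hi, rfl⟩
      have h1 := Set.ncard_lt_ncard hlt
      have h2 := Set.ncard_le_ncard this
      have h3 := Set.ncard_insert_le (none : Option ι) (some '' {i | ¬ thicken (R i) s x x})
      have h4 := Set.ncard_image_le (f := some) (s := {i | ¬ thicken (R i) s x x})
      exact h2.trans (by omega)

theorem exists_add_colors (j : ℕ) : ∀ {ι : Type} [Fintype ι] {M s : ℝ≥0∞} (_ : 0 < s)
    (_ : m < Fintype.card ι) {R : ι → Z → Z → Prop} (_ : ∀ i, IsPart (R i) (3 ^ j * s) M)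
    (_ : ∀ x ∈ Y, {i | ¬ R i x x}.ncard ≤ m)
    {c : ℕ} (_ : Fintype.card ι + j = c),
    ∃ R' : Fin c → Z → Z → Prop, (∀ i, IsPart (R' i) s (M + 3 ^ j * s)) ∧
      ∀ x ∈ Y, {i | ¬ R' i x x}.ncard ≤ m := by
  induction j with
  | zero =>
    intro ι _ M s hs hm R hR hY c hc
    obtain rfl : Fintype.card ι = c := hc
    refine ⟨fun i => R ((Fintype.equivFin ι).symm i), fun i => (hR _).mono (by simp) le_self_add,
      fun x hx => ?_⟩
    refine le_trans (le_of_eq ?_) (hY x hx)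
    exact Set.ncard_preimage_of_injective_subset_range (f := (Fintype.equivFin ι).symm)
      (s := {i | ¬ R i x x}) (Equiv.injective _) (by simp)
  | succ j ih =>
    intro ι _ M s hs hm R hR hY c hc
    have hs' : 0 < 3 ^ j * s := ENNReal.mul_pos (by simp) hs.ne'
    obtain ⟨R', hR', hY'⟩ := exists_add_color hs' hm
      (fun i => (hR i).mono (ε' := 3 * (3 ^ j * s)) (by rw [pow_succ', mul_assoc]) le_rfl) hY
    obtain ⟨R'', hR'', hY''⟩ := ih hs (by rw [Fintype.card_option]; omega) hR' hY'
      (c := c) (by rw [Fintype.card_option]; omega)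
    refine ⟨R'', fun i => (hR'' i).mono le_rfl (le_of_eq ?_), hY''⟩
    ring

/-- If `m + 1` colors cover every point of `Y`, then `k * m + 1` colors can be chosen such
that any `k` points of `Y` are covered by a common color: every point is missed by at most `m`
of them. -/
theorem exists_common_color {k : ℕ} (hk : 1 ≤ k) (hs : 0 < s) {R : Fin (m + 1) → Z → Z → Prop}
    (hR : ∀ i, IsPart (R i) (3 ^ (k * m - m) * s) M) (hY : ∀ x ∈ Y, ∃ i, R i x x) :
    ∃ R' : Fin (k * m + 1) → Z → Z → Prop,
      (∀ i, IsPart (R' i) s (M + 3 ^ (k * m - m) * s)) ∧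
      ∀ T : Set Z, T ⊆ Y → T.encard ≤ k → ∃ i, ∀ x ∈ T, R' i x x := by
  have hY' : ∀ x ∈ Y, {i | ¬ R i x x}.ncard ≤ m := fun x hx => by
    obtain ⟨i, hi⟩ := hY x hx
    have hlt : {i | ¬ R i x x} ⊂ Set.univ :=
      Set.ssubset_univ_iff.2 fun h => (h ▸ Set.mem_univ i : i ∈ {i | ¬ R i x x}) hi
    have := Set.ncard_lt_ncard hlt
    rw [Set.ncard_univ, Nat.card_eq_fintype_card, Fintype.card_fin] at this
    omega
  have hmk : m ≤ k * m := Nat.le_mul_of_pos_left m hk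
  obtain ⟨R', hR', hm⟩ := exists_add_colors (k * m - m) hs (by simp) hR hY' (c := k * m + 1)
    (by rw [Fintype.card_fin]; omega)
  refine ⟨R', hR', fun T hT hTk => ?_⟩
  by_contra! h
  have hfin : T.Finite := Set.finite_of_encard_le_coe hTk
  have hcard : hfin.toFinset.card ≤ k := by
    rw [hfin.encard_eq_coe_toFinset_card] at hTk
    exact_mod_cast hTk
  classical
  have hsub : (Finset.univ : Finset (Fin (k * m + 1))) ⊆
      hfin.toFinset.biUnion fun x => {i | ¬ R' i x x} := fun i _ => by
    obtain ⟨x, hx, hi⟩ := h i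
    simp only [Finset.mem_biUnion, Set.Finite.mem_toFinset, Finset.mem_filter, Finset.mem_univ,
      true_and]
    exact ⟨x, hx, hi⟩
  have h1 := Finset.card_le_card hsub
  have h2 := Finset.card_biUnion_le_card_mul hfin.toFinset
    (fun x => ({i | ¬ R' i x x} : Finset (Fin (k * m + 1)))) m fun x hx => by
      have := hm x (hT (hfin.mem_toFinset.1 hx))
      rwa [Set.ncard_eq_toFinset_card', Set.toFinset_ofPred] at this
  rw [Finset.card_univ, Fintype.card_fin] at h1
  have h3 := Nat.mul_le_mul_right m hcard
  omega

end Kolmogorov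

/-! ### Elements with well separated supports -/

section Lift

variable {F : Type u ⥤ Type u} {X : Type u}

/-- The relation on `FX` induced by a partial equivalence relation on `X`: `b` is obtained from `a`
by moving the points of the support of `a` injectively and within members of `R`. -/
def liftRel (F : Type u ⥤ Type u) {X : Type u} (R : X → X → Prop) (a b : F.obj X) : Prop :=
  ∃ τ : X → X, Set.InjOn τ (supp F a) ∧ fmap F τ a = b ∧ ∀ x ∈ supp F a, R x (τ x)

variable [FiniteSupports F] [PseudoEMetricSpace X]

/-- The set of elements of `F^p X` whose support has at most `k` points. -/
def suppLE (F : Type u ⥤ Type u) (p : ℝ≥0∞) (X : Type u) (k : ℕ) : Set (LpSpace F p X) :=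
  {a | (supp F (X := X) a).encard ≤ k}

/-- If the points in the supports of the elements of `B` are so far from each other that the
retraction of `exists_retraction` is injective on these supports, then close elements of `B` are
related by a bijection of their supports moving points by small distances. -/
theorem isPart_liftRel {p : ℝ≥0∞} (hp : 1 ≤ p) {n : ℕ} (hn : 1 ≤ n) (hdeg : HasDegreeLE F n)
    {ε M : ℝ≥0∞} {R : X → X → Prop} (hR : IsPart R ((n : ℝ≥0∞) ^ (1 - (p⁻¹).toReal) * ε) M)
    {k : ℕ} {B : Set (LpSpace F p X)} (hk : ∀ a ∈ B, (supp F (X := X) a).encard ≤ k)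
    (hB : ∀ a ∈ B, ∀ x ∈ supp F (X := X) a, ∀ y ∈ supp F (X := X) a, x ≠ y →
      (n : ℝ≥0∞) ^ (1 - (p⁻¹).toReal) * ε ≤ edist x y) :
    IsPart (fun a b : LpSpace F p X => a ∈ B ∧ b ∈ B ∧ liftRel F (X := X) R a b) ε
      ((k : ℝ≥0∞) ^ (p⁻¹).toReal * M) where
  symm := by
    rintro a _ ⟨ha, hb, τ, hτ, rfl, hRτ⟩
    refine ⟨hb, ha, ?_⟩
    obtain ⟨s, hs⟩ := exists_leftInverse_on hτ
    have hsupp := supp_fmap_of_injOn hτ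
    refine ⟨s, ?_, ?_, ?_⟩
    · rw [hsupp]
      rintro _ ⟨x, hx, rfl⟩ _ ⟨y, hy, rfl⟩ h
      rw [hs x hx, hs y hy] at h
      rw [h]
    · exact (fmap_fmap s τ _).trans (fmap_eq_self hs)
    · rw [hsupp]
      rintro _ ⟨x, hx, rfl⟩
      rw [hs x hx]
      exact hR.symm (hRτ x hx)
  trans := by
    rintro a _ _ ⟨ha, -, τ, hτ, rfl, hRτ⟩ ⟨-, hc, τ', hτ', rfl, hRτ'⟩
    rw [supp_fmap_of_injOn hτ] at hτ' hRτ'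
    exact ⟨ha, hc, τ' ∘ τ, hτ'.comp hτ (Set.mapsTo_image _ _), (fmap_fmap _ _ _).symm,
      fun x hx => hR.trans (hRτ x hx) (hRτ' _ ⟨x, hx, rfl⟩)⟩
  sep := by
    rintro a b ⟨ha, -, σ, -, -, hRa⟩ ⟨hb, -, σ', -, -, hRb⟩ hd
    refine ⟨ha, hb, ?_⟩
    obtain ⟨r, hr, hrd⟩ := exists_retraction hp hn hdeg hd
    have hinj : ∀ c ∈ B, Set.InjOn r (supp F (X := X) c) := fun c hc x hx y hy hxy => by
      by_contra hne
      exact (hB c hc x hx y hy hne).not_gt (hrd x y hxy)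
    obtain ⟨s, hs⟩ := exists_leftInverse_on (hinj b hb)
    have himg : r '' supp F (X := X) a = r '' supp F (X := X) b := by
      rw [← supp_fmap_of_injOn (hinj a ha), hr, supp_fmap_of_injOn (hinj b hb)]
    have hy : ∀ x ∈ supp F (X := X) a, ∃ y ∈ supp F (X := X) b, r y = r x ∧ s (r x) = y := by
      intro x hx
      have : r x ∈ r '' supp F (X := X) b := himg ▸ ⟨x, hx, rfl⟩
      obtain ⟨y, hy, hyx⟩ := this
      exact ⟨y, hy, hyx, by rw [← hyx, hs y hy]⟩
    refine ⟨s ∘ r, fun x hx x' hx' h => ?_, ?_, fun x hx => ?_⟩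
    · obtain ⟨y, -, hyx, h1⟩ := hy x hx
      obtain ⟨y', -, hyx', h2⟩ := hy x' hx'
      have : y = y' := by rw [← h1, ← h2]; exact h
      exact hinj a ha hx hx' (by rw [← hyx, ← hyx', this])
    · refine (fmap_fmap s r _).symm.trans ?_
      rw [hr]
      exact (fmap_fmap s r _).trans (fmap_eq_self hs)
    · obtain ⟨y, hyb, hyx, h1⟩ := hy x hx
      rw [Function.comp_apply, h1]
      exact hR.sep (hR.left (hRa x hx)) (hR.left (hRb y hyb)) (hrd x y hyx.symm)
  mesh := by
    rintro a _ ⟨ha, -, τ, -, rfl, hRτ⟩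
    exact lpDist_fmap_le hp (hk a ha) fun x hx => hR.mesh (hRτ x hx)

theorem cov_of_common_color {p : ℝ≥0∞} (hp : 1 ≤ p) {n : ℕ} (hn : 1 ≤ n) (hdeg : HasDegreeLE F n)
    {ε M : ℝ≥0∞} {I : Type*} {R : I → X → X → Prop}
    (hR : ∀ i, IsPart (R i) ((n : ℝ≥0∞) ^ (1 - (p⁻¹).toReal) * ε) M)
    {k : ℕ} (hcol : ∀ T : Set X, T.encard ≤ k → ∃ i, ∀ x ∈ T, R i x x)
    {B : Set (LpSpace F p X)} (hk : ∀ a ∈ B, (supp F (X := X) a).encard ≤ k)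
    (hB : ∀ a ∈ B, ∀ x ∈ supp F (X := X) a, ∀ y ∈ supp F (X := X) a, x ≠ y →
      (n : ℝ≥0∞) ^ (1 - (p⁻¹).toReal) * ε ≤ edist x y) :
    Cov B I ε ((k : ℝ≥0∞) ^ (p⁻¹).toReal * M) := by
  refine ⟨_, fun i => isPart_liftRel hp hn hdeg (hR i) hk hB, fun a ha => ?_⟩
  obtain ⟨i, hi⟩ := hcol _ (hk a ha)
  exact ⟨i, ha, ha, id, Set.injOn_id _, fmap_id (X := X) a, hi⟩

/-- Distinct elements with empty support are at infinite distance. -/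
theorem cov_supp_empty {p : ℝ≥0∞} (hp : 1 ≤ p) {n : ℕ} (hn : 1 ≤ n) (hdeg : HasDegreeLE F n)
    {ε : ℝ≥0∞} {I : Type*} [Nonempty I] :
    Cov (suppLE F p X 0) I ε 0 := by
  have hs : ∀ {a : LpSpace F p X} {r : X → X}, a ∈ suppLE F p X 0 → fmap F r a = a := by
    intro a r h
    have h0 : supp F (X := X) a = ∅ := by simpa [suppLE] using h
    exact fmap_eq_self (X := X) (by simp [h0])
  refine ⟨fun _ a b => a ∈ suppLE F p X 0 ∧ a = b, fun _ => ⟨?_, ?_, ?_, ?_⟩,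
    fun a ha => ⟨Classical.arbitrary I, ha, rfl⟩⟩
  · rintro a _ ⟨ha, rfl⟩
    exact ⟨ha, rfl⟩
  · rintro a _ _ ⟨ha, rfl⟩ ⟨-, rfl⟩
    exact ⟨ha, rfl⟩
  · rintro a b ⟨ha, -⟩ ⟨hb, -⟩ hd
    obtain ⟨r, hr, -⟩ := exists_retraction hp hn hdeg hd
    exact ⟨ha, (hs ha).symm.trans (hr.trans (hs hb))⟩
  · rintro a _ ⟨-, rfl⟩
    simp

/-- Elements whose support has two close points are close to elements with smaller support. -/
theorem exists_edist_lt_of_close {p : ℝ≥0∞} (hp : 1 ≤ p) {k : ℕ} {a : LpSpace F p X}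
    (ha : (supp F (X := X) a).encard ≤ (k + 1 : ℕ)) {x y : X} (hx : x ∈ supp F (X := X) a)
    (hy : y ∈ supp F (X := X) a) (hxy : x ≠ y) {r : ℝ≥0∞} (hr : edist x y < r) :
    ∃ b : LpSpace F p X, (supp F (X := X) b).encard ≤ k ∧ edist a b < r := by
  classical
  refine ⟨fmap F (Function.update id x y) a, ?_, (lpDist_fmap_update_le hp hx).trans_lt hr⟩
  have hsub : supp F (fmap F (Function.update id x y) a) ⊆ supp F (X := X) a \ {x} := by
    refine (supp_fmap_subset _ _).trans ?_
    rintro _ ⟨z, hz, rfl⟩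
    by_cases hzx : z = x
    · subst hzx
      rw [Function.update_self]
      exact ⟨hy, hxy.symm⟩
    · rw [Function.update_of_ne hzx]
      exact ⟨hz, hzx⟩
  refine (Set.encard_le_encard hsub).trans ?_
  have h := Set.encard_sdiff_singleton_add_one hx
  rw [← h] at ha
  push_cast at ha
  exact (ENat.add_le_add_iff_right (by simp)).1 ha

end Lift

/-! ### The inductive construction of covers -/

section Induction

variable {F : Type u ⥤ Type u} [FiniteSupports F] {X : Type u} [PseudoEMetricSpace X]

/-- The elements with two points of the support at distance `< r` form a neighborhood of the set
of elements with smaller support, and the remaining ones have well separated supports. -/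
theorem Cov.succ {p : ℝ≥0∞} (hp : 1 ≤ p) {n : ℕ} (hn : 1 ≤ n) (hdeg : HasDegreeLE F n)
    {k : ℕ} {ε r δ M : ℝ≥0∞} (hε : 0 < ε)
    (hr : (n : ℝ≥0∞) ^ (1 - (p⁻¹).toReal) * ε ≤ r)
    (hδ : ((k + 1 : ℕ) : ℝ≥0∞) ^ (p⁻¹).toReal * δ ≠ ∞) {I : Type*} {R : I → X → X → Prop}
    (hR : ∀ i, IsPart (R i) ((n : ℝ≥0∞) ^ (1 - (p⁻¹).toReal) * ε) δ)
    (hcol : ∀ T : Set X, T.encard ≤ (k + 1 : ℕ) → ∃ i, ∀ x ∈ T, R i x x)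
    (hA : Cov (suppLE F p X k) I
      (2 * ε + ((k + 1 : ℕ) : ℝ≥0∞) ^ (p⁻¹).toReal * δ + 2 * r) M) :
    Cov (suppLE F p X (k + 1)) I ε
      (M + 2 * r + 2 * ε + 2 * (((k + 1 : ℕ) : ℝ≥0∞) ^ (p⁻¹).toReal * δ)) := by
  let B : Set (LpSpace F p X) := {a | (supp F (X := X) a).encard ≤ (k + 1 : ℕ) ∧
    ∀ x ∈ supp F (X := X) a, ∀ y ∈ supp F (X := X) a, x ≠ y → r ≤ edist x y}
  have hB : Cov B I ε (((k + 1 : ℕ) : ℝ≥0∞) ^ (p⁻¹).toReal * δ) :=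
    cov_of_common_color hp hn hdeg hR hcol (fun a ha => ha.1)
      fun a ha x hx y hy hxy => hr.trans (ha.2 x hx y hy hxy)
  have hA' := hA.thicken (B := suppLE F p X (k + 1) \ B) (by
    rintro a ⟨ha, haB⟩
    have : ∃ x ∈ supp F (X := X) a, ∃ y ∈ supp F (X := X) a, x ≠ y ∧ edist x y < r := by
      by_contra! h
      exact haB ⟨ha, h⟩
    obtain ⟨x, hx, y, hy, hxy, hd⟩ := this
    exact exists_edist_lt_of_close hp ha hx hy hxy hd)
  refine (hA'.union hε hδ hB).mono (fun a ha => ?_) le_rfl le_rfl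
  by_cases h : a ∈ B
  · exact Or.inr h
  · exact Or.inl ⟨ha, h⟩

theorem extend_of_pos {D : GaugeFun} {y : ℝ≥0∞} (h0 : 0 < y) (h : y < ∞) :
    extend D y = D ⟨y.toReal, ENNReal.toReal_pos h0.ne' h.ne⟩ :=
  dif_pos ⟨h0, h⟩

/-- The estimate for `F^p_k X`, given covers of `X` by the colors `I 1` and, for `k ≥ 2`, colorings
of `X` for which any `k` points have a common color. -/
theorem cov_controlSeq {p : ℝ≥0∞} (hp : 1 ≤ p) {n N : ℕ} (hn : 1 ≤ n) (hN : 1 ≤ N)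
    (hdeg : HasDegreeLE F n) {D : GaugeFun} {e e' : ℕ → ℕ} (he : ∀ k, 2 ≤ k → e k = e' k + 1)
    {I : ℕ → Type*} [∀ k, Nonempty (I k)] (hI : ∀ k, Nonempty (I k ↪ I (k + 1)))
    (h1 : ∀ s : ℝ≥0∞, 0 < s → s < ∞ → Cov (Set.univ : Set X) (I 1) s (extend D s))
    (hcol : ∀ k, 2 ≤ k → ∀ s : ℝ≥0∞, 0 < s → s < ∞ → ∃ R : I k → X → X → Prop,
      (∀ i, IsPart (R i) s (extend D (3 ^ e' k * s) + 3 ^ e' k * s)) ∧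
      ∀ T : Set X, T.encard ≤ k → ∃ i, ∀ x ∈ T, R i x x)
    (k : ℕ) (hk : 1 ≤ k) (ε : Set.Ioi (0 : ℝ)) :
    Cov (suppLE F p X k) (I k) (ENNReal.ofReal ε)
      (controlSeq p n N e D k ε) := by
  have hn1 : (1 : ℝ≥0∞) ≤ n := by exact_mod_cast hn
  have hN1 : (1 : ℝ≥0∞) ≤ N := by exact_mod_cast hN
  have hp0 : 0 ≤ (p⁻¹).toReal := ENNReal.toReal_nonneg
  have hp1 : (p⁻¹).toReal ≤ 1 := by
    simpa using ENNReal.toReal_mono ENNReal.one_ne_top (ENNReal.inv_le_one.2 hp)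
  have hc1 : (1 : ℝ≥0∞) ≤ (n : ℝ≥0∞) ^ (1 - (p⁻¹).toReal) := by
    simpa using ENNReal.rpow_le_rpow hn1 (sub_nonneg.2 hp1)
  have hcn : (n : ℝ≥0∞) ^ (1 - (p⁻¹).toReal) ≤ n := by
    conv_rhs => rw [← ENNReal.rpow_one (n : ℝ≥0∞)]
    exact ENNReal.rpow_le_rpow_of_exponent_le hn1 (by linarith)
  induction k, hk using Nat.le_induction generalizing ε with
  | base =>
    have hε : 0 < ENNReal.ofReal ε := ENNReal.ofReal_pos.2 ε.2
    obtain ⟨R, hR, hx⟩ := h1 ((n : ℝ≥0∞) ^ (1 - (p⁻¹).toReal) * ENNReal.ofReal ε)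
      (ENNReal.mul_pos (zero_lt_one.trans_le hc1).ne' hε.ne')
      (ENNReal.mul_lt_top (hcn.trans_lt (ENNReal.natCast_lt_top n)) ENNReal.ofReal_lt_top)
    have h := cov_of_common_color hp hn hdeg hR (k := 1) (B := suppLE F p X 1)
      (fun T hT => ?_) (fun a ha => ha)
      (fun a ha x hx y hy hxy =>
        (hxy (Set.encard_le_one_iff.1 (by simpa [suppLE] using ha) x y hx hy)).elim)
    · refine h.mono subset_rfl le_rfl ?_
      simp [controlSeq]
    · rcases T.eq_empty_or_nonempty with rfl | ⟨x, hxT⟩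
      · exact ⟨Classical.arbitrary _, by simp⟩
      · obtain ⟨i, hi⟩ := hx x trivial
        refine ⟨i, fun y hy => ?_⟩
        have hT : T.encard ≤ 1 := by simpa using hT
        rwa [Set.encard_le_one_iff.1 hT y x hy hxT]
  | succ k hk ih =>
    obtain ⟨k, rfl⟩ : ∃ j, k = j + 1 := ⟨k - 1, by omega⟩
    have hε : 0 < ENNReal.ofReal ε := ENNReal.ofReal_pos.2 ε.2
    have hεt : ENNReal.ofReal ε ≠ ∞ := ENNReal.ofReal_ne_top
    obtain ⟨ι⟩ := hI (k + 1)
    generalize hE : ENNReal.ofReal (ε : ℝ) = E at *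
    -- The available separation exceeds the needed one `n ^ (1 - 1/p) * ε` by a factor at least `6`.
    obtain ⟨R, hR, hRT⟩ := hcol (k + 2) (by omega) (2 * n * N * 3 * E)
      (by positivity) (by finiteness)
    have hη : (3 : ℝ≥0∞) ^ e' (k + 2) * (2 * n * N * 3 * E) = 2 * n * N * 3 ^ e (k + 2) * E := by
      rw [he (k + 2) (by omega), pow_succ]
      ring
    rw [hη] at hR
    simp only [controlSeq, hE]
    generalize 2 * (n : ℝ≥0∞) * N * 3 ^ e (k + 2) * E = η at *
    generalize hδ : extend D η + η = δ at *
    have hc : ((k + 2 : ℕ) : ℝ≥0∞) ^ (p⁻¹).toReal ≠ 0 := by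
      simp only [ne_eq, ENNReal.rpow_eq_zero_iff, not_or]
      exact ⟨fun h => by simp at h, fun h => by simp at h⟩
    -- If `D` is infinite at the relevant scale, then the whole space is admissible as one member.
    by_cases hcδ : ((k + 2 : ℕ) : ℝ≥0∞) ^ (p⁻¹).toReal * δ = ∞
    · rw [mul_assoc 2, hcδ]
      simp only [ENNReal.mul_top (two_ne_zero), add_top, top_add]
      exact cov_top
    have hnN : (n : ℝ≥0∞) ^ (1 - (p⁻¹).toReal) * E ≤ n * N * E := by
      gcongr
      exact hcn.trans (le_mul_of_one_le_right' hN1)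
    have hbig : (n : ℝ≥0∞) ^ (1 - (p⁻¹).toReal) * E ≤ 2 * n * N * 3 * E := by
      refine hnN.trans ?_
      calc (n : ℝ≥0∞) * N * E ≤ n * N * E * 6 := le_mul_of_one_le_right' (by norm_num)
        _ = 2 * n * N * 3 * E := by ring
    have hy0 : 0 < 2 * E * (1 + n * N) + ((k + 2 : ℕ) : ℝ≥0∞) ^ (p⁻¹).toReal * δ := by
      positivity
    have hyt : 2 * E * (1 + n * N) + ((k + 2 : ℕ) : ℝ≥0∞) ^ (p⁻¹).toReal * δ < ∞ := by
      finiteness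
    have hA := ih ⟨_, ENNReal.toReal_pos hy0.ne' hyt.ne⟩
    rw [ENNReal.ofReal_toReal hyt.ne,
      ← extend_of_pos (D := controlSeq p n N e D (k + 1)) hy0 hyt] at hA
    refine (Cov.succ hp hn hdeg hε (r := n * N * E) hnN hcδ
      (fun i => (hR i).mono hbig le_rfl) hRT
      ((hA.embed ι).mono le_rfl (le_of_eq ?_) le_rfl)).mono le_rfl le_rfl ?_
    · ring
    · generalize extend (controlSeq p n N e D (k + 1)) _ = M
      calc M + 2 * (n * N * E) + 2 * E + 2 * (((k + 2 : ℕ) : ℝ≥0∞) ^ (p⁻¹).toReal * δ)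
          = (2 + 2 * n * N) * E + 2 * ((k + 2 : ℕ) : ℝ≥0∞) ^ (p⁻¹).toReal * δ + M := by ring
        _ ≤ _ := by
          gcongr
          norm_num

end Induction

/-! ### Controlled dimension in terms of partial equivalence relations -/

section ControlledDim

variable {Z : Type u} [PseudoEMetricSpace Z] {D : GaugeFun} {κ : Cardinal.{u}}

instance nonempty_one_add_out (κ : Cardinal.{u}) : Nonempty (1 + κ).out := by
  rw [← Cardinal.mk_ne_zero_iff, Cardinal.mk_out]
  simp

theorem ControlledDimLE.cov (h : ControlledDimLE D Z κ) {s : ℝ≥0∞} (hs : 0 < s) (hs' : s < ∞) :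
    Cov (Set.univ : Set Z) (1 + κ).out s (extend D s) := by
  obtain ⟨𝒰, hU, hmesh, hsep⟩ := h ⟨s.toReal, ENNReal.toReal_pos hs.ne' hs'.ne⟩
  rw [← extend_of_pos (D := D) hs hs'] at hmesh
  rw [ENNReal.ofReal_toReal hs'.ne] at hsep
  have hd : ∀ i, ∀ U ∈ 𝒰 i, ∀ V ∈ 𝒰 i, ∀ x ∈ U, ∀ y ∈ V, edist x y < s → U = V := by
    intro i U hU V hV x hx y hy hxy
    by_contra hne
    refine hxy.not_ge (((hsep.trans (iInf_le _ i)).trans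
      (iInf₂_le_of_le U hU (iInf₂_le_of_le V hV (iInf_le _ hne)))).trans ?_)
    exact iInf₂_le_of_le x hx (iInf₂_le y hy)
  refine ⟨fun i x y => ∃ U ∈ 𝒰 i, x ∈ U ∧ y ∈ U, fun i => ⟨?_, ?_, ?_, ?_⟩, fun x _ => ?_⟩
  · rintro x y ⟨U, hU, hx, hy⟩
    exact ⟨U, hU, hy, hx⟩
  · rintro x y z ⟨U, hU, hx, hy⟩ ⟨V, hV, hy', hz⟩
    obtain rfl := hd i U hU V hV y hy y hy' (by simpa using hs)
    exact ⟨U, hU, hx, hz⟩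
  · rintro x y ⟨U, hU, hx, -⟩ ⟨V, hV, hy, -⟩ hxy
    obtain rfl := hd i U hU V hV x hx y hy hxy
    exact ⟨U, hU, hx, hy⟩
  · rintro x y ⟨U, hU, hx, hy⟩
    exact (Metric.edist_le_ediam_of_mem hx hy).trans
      ((le_iSup₂ (f := fun U _ => Metric.ediam U) U (Set.mem_iUnion.2 ⟨i, hU⟩)).trans hmesh)
  · have : x ∈ ⋃₀ (⋃ i, 𝒰 i) := hU ▸ trivial
    obtain ⟨U, hU', hx⟩ := this
    obtain ⟨i, hi⟩ := Set.mem_iUnion.1 hU'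
    exact ⟨i, U, hi, hx, hx⟩

theorem controlledDimLE_of_cov
    (h : ∀ ε : Set.Ioi (0 : ℝ), Cov (Set.univ : Set Z) (1 + κ).out (ENNReal.ofReal ε) (D ε)) :
    ControlledDimLE D Z κ := by
  intro ε
  obtain ⟨R, hR, hx⟩ := h ε
  refine ⟨fun i => {U | ∃ x, R i x x ∧ U = {y | R i x y}}, ?_, ?_, ?_⟩
  · refine Set.eq_univ_of_forall fun x => ?_
    obtain ⟨i, hi⟩ := hx x trivial
    exact ⟨_, Set.mem_iUnion.2 ⟨i, x, hi, rfl⟩, hi⟩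
  · refine iSup₂_le fun U hU => ?_
    obtain ⟨i, x, -, rfl⟩ := Set.mem_iUnion.1 hU
    exact Metric.ediam_le fun y hy z hz => (hR i).mesh ((hR i).trans ((hR i).symm hy) hz)
  · refine le_iInf fun i => le_iInf₂ fun U hU => le_iInf₂ fun V hV => le_iInf fun hne =>
      le_iInf₂ fun y hy => le_iInf₂ fun z hz => ?_
    obtain ⟨x, -, rfl⟩ := hU
    obtain ⟨x', -, rfl⟩ := hV
    by_contra! hlt
    refine hne ?_
    have hyz := (hR i).sep ((hR i).right hy) ((hR i).right hz) hlt
    have hxx : R i x x' := (hR i).trans ((hR i).trans hy hyz) ((hR i).symm hz)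
    ext w
    exact ⟨fun hw => (hR i).trans ((hR i).symm hxx) hw, fun hw => (hR i).trans hxx hw⟩

theorem controlledDim_le_of_cov {J : Type*} (f : J ↪ (1 + κ).out)
    (h : ∀ ε : Set.Ioi (0 : ℝ), Cov (Set.univ : Set Z) J (ENNReal.ofReal ε) (D ε)) :
    controlledDim D Z ≤ κ :=
  csInf_le' (controlledDimLE_of_cov fun ε => (h ε).embed f)

/-- The infimum in the definition of the controlled dimension is attained: the cover by singletons
of pairwise different colors shows that the set of admissible cardinals contains `#Z`. -/
theorem controlledDimLE_controlledDim (D : GaugeFun) (Z : Type u) [PseudoEMetricSpace Z] :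
    ControlledDimLE D Z (controlledDim D Z) := by
  refine csInf_mem (s := {κ | ControlledDimLE D Z κ})
    ⟨Cardinal.mk Z, controlledDimLE_of_cov fun ε => ?_⟩
  have h : Cov (Set.univ : Set Z) Z (ENNReal.ofReal ε) (D ε) := by
    refine ⟨fun z x y => z = x ∧ z = y, fun z => ⟨And.symm, fun h h' => ⟨h.1, h'.2⟩,
      fun h h' _ => ⟨h.1, h'.1⟩, ?_⟩, fun x _ => ⟨x, rfl, rfl⟩⟩
    rintro _ _ ⟨rfl, rfl⟩
    simp
  have hle : Cardinal.mk Z ≤ Cardinal.mk (1 + Cardinal.mk Z).out := by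
    rw [Cardinal.mk_out]
    exact le_add_self
  exact h.embed (Classical.choice hle)

theorem Cov.subtype {Z : Type*} [PseudoEMetricSpace Z] {A : Set Z} {I : Type*} {ε M : ℝ≥0∞}
    (h : Cov A I ε M) : Cov (Set.univ : Set A) I ε M := by
  obtain ⟨R, hR, hA⟩ := h
  exact ⟨fun i x y => R i x y, fun i => (hR i).comap isometry_subtype_coe, fun x _ => hA x x.2⟩

theorem cov_of_isEmpty {Z : Type*} [PseudoEMetricSpace Z] [IsEmpty Z] {A : Set Z} {I : Type*}
    {ε M : ℝ≥0∞} : Cov A I ε M :=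
  ⟨fun _ _ _ => False, fun _ => isPart_false, fun x _ => isEmptyElim x⟩

theorem nonempty_equiv_fin (m : ℕ) : Nonempty ((1 + (m : Cardinal.{u})).out ≃ Fin (m + 1)) := by
  rw [← Cardinal.mk_eq_nat_iff, Cardinal.mk_out]
  push_cast
  exact add_comm _ _

end ControlledDim

/-! ### Covers of the subspaces of elements with small supports -/

section Main

variable {F : Type u ⥤ Type u} [FiniteSupports F] {X : Type u} [PseudoEMetricSpace X]

theorem HasDegreeLE.mono {F : Type u ⥤ Type u} {m n : ℕ} (h : HasDegreeLE F m) (hmn : m ≤ n) :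
    HasDegreeLE F n := fun X a => (h X a).trans (by exact_mod_cast hmn)

theorem hasDegreeLE_deg {F : Type u ⥤ Type u} (h : HasFiniteDegree F) : HasDegreeLE F (deg F) :=
  Nat.sInf_mem h

omit [FiniteSupports F] [PseudoEMetricSpace X] in
theorem suppLE_eq_univ {p : ℝ≥0∞} {n : ℕ} (h : HasDegreeLE F n) :
    suppLE F p X n = Set.univ :=
  Set.eq_univ_of_forall fun a => h X a

theorem isEmpty_or_one_le_card {F : Type u ⥤ Type u} (hF : IsFinitary F) (p : ℝ≥0∞) {n : ℕ}
    (hn : 1 ≤ n) (X : Type u) :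
    IsEmpty (LpSpace F p X) ∨ 1 ≤ Nat.card (F.obj (Ord.{u} n)) := by
  rcases isEmpty_or_nonempty (LpSpace F p X) with h | ⟨⟨a⟩⟩
  · exact Or.inl h
  · refine Or.inr ?_
    have : Finite (F.obj (Ord.{u} n)) := hF _ inferInstance
    have : Nonempty (F.obj (Ord.{u} n)) := ⟨fmap F (fun _ => ⟨⟨0, hn⟩⟩) (X := X) a⟩
    exact Nat.card_pos

theorem cov_suppLE_of_finite {p : ℝ≥0∞} (hp : 1 ≤ p) {n : ℕ} (hn : 1 ≤ n)
    (hdeg : HasDegreeLE F n) (hF : IsFinitary F) {D : GaugeFun} {m : ℕ}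
    (hm : controlledDim D X = m) (k : ℕ) (ε : Set.Ioi (0 : ℝ)) :
    Cov (suppLE F p X k) (Fin (k * m + 1)) (ENNReal.ofReal ε)
      (controlSeq p n (Nat.card (F.obj (Ord.{u} n))) (fun k => k * m - m + 1) D k ε) := by
  rcases Nat.eq_zero_or_pos k with rfl | hk
  · exact cov_supp_empty hp hn hdeg
  rcases isEmpty_or_one_le_card hF p hn X with h | hN
  · exact cov_of_isEmpty
  obtain ⟨f⟩ := nonempty_equiv_fin.{u} m
  have hX : ∀ s : ℝ≥0∞, 0 < s → s < ∞ →
      Cov (Set.univ : Set X) (Fin (m + 1)) s (extend D s) := fun s hs hs' =>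
    ((hm ▸ controlledDimLE_controlledDim D X : ControlledDimLE D X m).cov hs hs').embed
      f.toEmbedding
  refine cov_controlSeq hp hn hN hdeg (e' := fun k => k * m - m) (I := fun k => Fin (k * m + 1))
    (fun _ _ => rfl) (fun k => ⟨Fin.castLEEmb (by gcongr; omega)⟩)
    (fun s hs hs' => by simpa using hX s hs hs') (fun k hk s hs hs' => ?_) k hk ε
  obtain ⟨R, hR, hx⟩ := hX (3 ^ (k * m - m) * s) (by positivity) (by finiteness)
  obtain ⟨R', hR', hT⟩ := exists_common_color (k := k) (by omega) hs hR hx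
  exact ⟨R', hR', fun T hTk => hT T (Set.subset_univ T) hTk⟩

/-- With infinitely many colors, any `k` points of `X` can be covered by a common color:
the new colors are pairs consisting of a `k`-tuple of old colors and of one of the
`k * (k - 1) + 1` colors obtained from this tuple. -/
theorem exists_common_color_of_infinite {J : Type u} [Infinite J] {k : ℕ} (hk : 1 ≤ k)
    {s M : ℝ≥0∞} (hs : 0 < s)
    (h : Cov (Set.univ : Set X) J (3 ^ (k * (k - 1) - (k - 1)) * s) M) :
    ∃ R : J → X → X → Prop,
      (∀ j, IsPart (R j) s (M + 3 ^ (k * (k - 1) - (k - 1)) * s)) ∧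
      ∀ T : Set X, T.encard ≤ k → ∃ j, ∀ x ∈ T, R j x x := by
  obtain ⟨R, hR, hx⟩ := h
  choose φ hφ using fun x => hx x trivial
  choose S hS hST using fun c : Fin (k - 1 + 1) → J =>
    exists_common_color (Y := {x | ∃ i, R (c i) x x}) (k := k) hk hs (fun i => hR (c i))
      fun x hx => hx
  have hcard : Cardinal.mk ((Fin (k - 1 + 1) → J) × Fin (k * (k - 1) + 1)) ≤ Cardinal.mk J := by
    have hJ := Cardinal.aleph0_le_mk J
    rw [Cardinal.mk_prod, Cardinal.mk_pi]
    simp only [Cardinal.prod_const, Cardinal.mk_fin, Cardinal.lift_natCast,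
      Cardinal.lift_uzero]
    exact Cardinal.mul_le_of_le hJ (Cardinal.power_nat_le hJ) (Cardinal.natCast_le_aleph0.trans hJ)
  obtain ⟨f⟩ := hcard
  have : Nonempty J := inferInstance
  have hf := Function.invFun_surjective f.injective
  refine ⟨fun j => S (Function.invFun f j).1 (Function.invFun f j).2, fun j => hS _ _,
    fun T hT => ?_⟩
  have hfin : T.Finite := Set.finite_of_encard_le_coe hT
  have hle : T.ncard ≤ k := by
    rw [← hfin.cast_ncard_eq] at hT
    exact_mod_cast hT
  have := hfin.to_subtype
  let e : T ≃ Fin T.ncard := Finite.equivFin T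
  let c : Fin (k - 1 + 1) → J := fun i =>
    if h : (i : ℕ) < T.ncard then φ (e.symm ⟨i, h⟩) else Classical.arbitrary J
  obtain ⟨i, hi⟩ := hST c T (fun x hxT => ⟨⟨e ⟨x, hxT⟩, by omega⟩, by simp [c, hφ]⟩) hT
  obtain ⟨j, hj⟩ := hf (c, i)
  exact ⟨j, by simpa only [hj] using hi⟩

theorem cov_suppLE_of_infinite {p : ℝ≥0∞} (hp : 1 ≤ p) {n : ℕ} (hn : 1 ≤ n)
    (hdeg : HasDegreeLE F n) (hF : IsFinitary F) {D : GaugeFun}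
    (hD : Cardinal.aleph0 ≤ controlledDim D X) (k : ℕ) (ε : Set.Ioi (0 : ℝ)) :
    Cov (suppLE F p X k) (1 + controlledDim D X).out (ENNReal.ofReal ε)
      (controlSeq p n (Nat.card (F.obj (Ord.{u} n))) (fun k => k ^ 2 - 2 * k + 2) D k ε) := by
  rcases Nat.eq_zero_or_pos k with rfl | hk
  · exact cov_supp_empty hp hn hdeg
  rcases isEmpty_or_one_le_card hF p hn X with h | hN
  · exact cov_of_isEmpty
  have hinf : Infinite (1 + controlledDim D X).out := by
    rw [Cardinal.infinite_iff, Cardinal.mk_out]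
    exact hD.trans le_add_self
  have hX := fun s : ℝ≥0∞ => (controlledDimLE_controlledDim D X).cov (s := s)
  refine cov_controlSeq hp hn hN hdeg (e' := fun k => k * (k - 1) - (k - 1))
    (I := fun _ => (1 + controlledDim D X).out) (fun k hk => ?_) (fun k => ⟨.refl _⟩)
    (fun s hs hs' => hX s hs hs') (fun k hk s hs hs' => ?_) k hk ε
  · obtain ⟨j, rfl⟩ := Nat.exists_eq_add_of_le' hk
    have h1 : (j + 2) ^ 2 = j ^ 2 + 2 * j + 2 * (j + 2) := by ring
    have h2 : (j + 2) * (j + 2 - 1) = (j ^ 2 + 2 * j + 1) + (j + 2 - 1) := by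
      rw [Nat.add_sub_assoc (by norm_num)]
      ring
    rw [h1, h2, Nat.add_sub_cancel, Nat.add_sub_cancel]
  · exact exists_common_color_of_infinite (by omega) hs
      (hX _ (by positivity) (by finiteness))

end Main

/-! ### Dimension controlling scales -/

section Scales

theorem IsControl.extend_mono {f : GaugeFun} (hf : IsControl f) : Monotone (extend f) := by
  intro y z hyz
  rcases eq_zero_or_pos y with rfl | hy
  · simp [extend]
  rcases eq_or_ne z ∞ with rfl | hz
  · simp [extend]
  have hy' : y < ∞ := hyz.trans_lt hz.lt_top
  rw [extend_of_pos hy hy', extend_of_pos (hy.trans_le hyz) hz.lt_top]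
  exact hf.1 (ENNReal.toReal_mono hz hyz)

theorem IsControl.extend_pos {f : GaugeFun} (hf : IsControl f) {y : ℝ≥0∞} (hy : 0 < y) :
    0 < extend f y := by
  unfold extend
  split_ifs
  · exact hf.2 _
  · exact hy

theorem isControl_id : IsControl (fun x => ENNReal.ofReal (x : ℝ)) :=
  ⟨fun _ _ h => ENNReal.ofReal_le_ofReal h, fun x => ENNReal.ofReal_pos.2 x.2⟩

theorem IsControl.add {f g : GaugeFun} (hf : IsControl f) (hg : IsControl g) :
    IsControl (fun x => f x + g x) :=
  ⟨fun _ _ h => add_le_add (hf.1 h) (hg.1 h), fun x => (hf.2 x).trans_le le_self_add⟩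

theorem IsControl.comp {f g : GaugeFun} (hf : IsControl f) (hg : IsControl g) :
    IsControl (fun x => extend f (g x)) :=
  ⟨fun _ _ h => hf.extend_mono (hg.1 h), fun x => hf.extend_pos (hg.2 x)⟩

theorem mem_scaleAN_iff {f : GaugeFun} :
    f ∈ scaleAN ↔ IsControl f ∧ ∃ C : ℝ≥0∞, C < ∞ ∧ ∀ x, f x ≤ C * ENNReal.ofReal x := by
  have hx : ∀ x : Set.Ioi (0 : ℝ), ENNReal.ofReal x ≠ 0 := fun x => (ENNReal.ofReal_pos.2 x.2).ne'
  constructor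
  · rintro ⟨h, -, hs⟩
    refine ⟨h, _, hs, fun x => ?_⟩
    rw [← ENNReal.div_le_iff (hx x) ENNReal.ofReal_ne_top]
    exact le_iSup (fun x : Set.Ioi (0 : ℝ) => f x / ENNReal.ofReal x) x
  · rintro ⟨h, C, hC, hf⟩
    refine ⟨h, fun x => (hf x).trans_lt (ENNReal.mul_lt_top hC ENNReal.ofReal_lt_top),
      lt_of_le_of_lt (iSup_le fun x => ?_) hC⟩
    rw [ENNReal.div_le_iff (hx x) ENNReal.ofReal_ne_top]
    exact hf x

theorem isScale_scaleAN : IsScale scaleAN where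
  control f hf := hf.1
  id_mem := mem_scaleAN_iff.2 ⟨isControl_id, 1, ENNReal.one_lt_top, fun x => by simp⟩
  add_mem f hf g hg := by
    obtain ⟨hf, C, hC, hfC⟩ := mem_scaleAN_iff.1 hf
    obtain ⟨hg, C', hC', hgC'⟩ := mem_scaleAN_iff.1 hg
    refine mem_scaleAN_iff.2 ⟨hf.add hg, C + C', ENNReal.add_lt_top.2 ⟨hC, hC'⟩, fun x => ?_⟩
    rw [add_mul]
    exact add_le_add (hfC x) (hgC' x)
  comp_mem f hf g hg := by
    obtain ⟨hf, C, hC, hfC⟩ := mem_scaleAN_iff.1 hf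
    obtain ⟨hg', C', hC', hgC'⟩ := mem_scaleAN_iff.1 hg
    refine mem_scaleAN_iff.2 ⟨hf.comp hg', C * C', ENNReal.mul_lt_top hC hC', fun x => ?_⟩
    rw [extend_of_pos (hg'.2 x) (hg.2.1 x), mul_assoc]
    refine (hfC _).trans ?_
    rw [ENNReal.ofReal_toReal (hg.2.1 x).ne]
    gcongr
    exact hgC' x
  mem_of_le f hf g hg hgf := by
    obtain ⟨hf, C, hC, hfC⟩ := mem_scaleAN_iff.1 hf
    exact mem_scaleAN_iff.2 ⟨hg, C, hC, fun x => (hgf x).trans (hfC x)⟩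

theorem isScale_scaleAS : IsScale scaleAS where
  control f hf := hf.1
  id_mem := ⟨isControl_id, fun x => ENNReal.ofReal_lt_top⟩
  add_mem f hf g hg := ⟨hf.1.add hg.1, fun x => ENNReal.add_lt_top.2 ⟨hf.2 x, hg.2 x⟩⟩
  comp_mem f hf g hg := ⟨hf.1.comp hg.1, fun x => by
    beta_reduce
    rw [extend_of_pos (hg.1.2 x) (hg.2 x)]
    exact hf.2 _⟩
  mem_of_le f hf g hg hgf := ⟨hg, fun x => (hgf x).trans_lt (hf.2 x)⟩

theorem mem_scaleU_iff {f : GaugeFun} :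
    f ∈ scaleU ↔ IsControl f ∧ ∀ δ : ℝ≥0∞, 0 < δ → ∃ r, f r ≤ δ := by
  refine and_congr_right fun hf => ?_
  rw [comap_coe_Ioi_nhdsGT, ENNReal.tendsto_nhds_zero]
  refine forall₂_congr fun δ _ => ?_
  rw [Filter.eventually_atBot]
  exact ⟨fun ⟨r, hr⟩ => ⟨r, hr r le_rfl⟩, fun ⟨r, hr⟩ => ⟨r, fun x hx => (hf.1 hx).trans hr⟩⟩

theorem isScale_scaleU : IsScale scaleU where
  control f hf := hf.1
  id_mem := mem_scaleU_iff.2 ⟨isControl_id, fun δ hδ => by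
    have h1 : min δ 1 ≠ ∞ := ((min_le_right _ _).trans_lt ENNReal.one_lt_top).ne
    refine ⟨⟨(min δ 1).toReal, ENNReal.toReal_pos (lt_min hδ one_pos).ne' h1⟩, ?_⟩
    rw [ENNReal.ofReal_toReal h1]
    exact min_le_left _ _⟩
  add_mem f hf g hg := by
    obtain ⟨hf, hf'⟩ := mem_scaleU_iff.1 hf
    obtain ⟨hg, hg'⟩ := mem_scaleU_iff.1 hg
    refine mem_scaleU_iff.2 ⟨hf.add hg, fun δ hδ => ?_⟩
    obtain ⟨r, hr⟩ := hf' (δ / 2) (ENNReal.half_pos hδ.ne')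
    obtain ⟨r', hr'⟩ := hg' (δ / 2) (ENNReal.half_pos hδ.ne')
    refine ⟨min r r', ?_⟩
    rw [← ENNReal.add_halves δ]
    exact add_le_add ((hf.1 (min_le_left _ _)).trans hr) ((hg.1 (min_le_right _ _)).trans hr')
  comp_mem f hf g hg := by
    obtain ⟨hf, hf'⟩ := mem_scaleU_iff.1 hf
    obtain ⟨hg, hg'⟩ := mem_scaleU_iff.1 hg
    refine mem_scaleU_iff.2 ⟨hf.comp hg, fun δ hδ => ?_⟩
    obtain ⟨r, hr⟩ := hf' δ hδ
    have hr0 : 0 < ENNReal.ofReal r := ENNReal.ofReal_pos.2 r.2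
    obtain ⟨s, hs⟩ := hg' _ hr0
    refine ⟨s, (hf.extend_mono hs).trans ?_⟩
    rw [extend_of_pos hr0 ENNReal.ofReal_lt_top]
    refine le_trans (hf.1 ?_) hr
    exact (ENNReal.toReal_ofReal (le_of_lt r.2)).le
  mem_of_le f hf g hg hgf := by
    obtain ⟨hf, hf'⟩ := mem_scaleU_iff.1 hf
    refine mem_scaleU_iff.2 ⟨hg, fun δ hδ => ?_⟩
    obtain ⟨r, hr⟩ := hf' δ hδ
    exact ⟨r, (hgf r).trans hr⟩

theorem IsScale.const_mul_mem {𝒟 : Set GaugeFun} (h𝒟 : IsScale 𝒟) {f : GaugeFun} (hf : f ∈ 𝒟)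
    {c : ℝ≥0∞} (hc0 : 0 < c) (hc : c < ∞) : (fun x => c * f x : GaugeFun) ∈ 𝒟 := by
  have hnat : ∀ K : ℕ, (fun x => ((K + 1 : ℕ) : ℝ≥0∞) * f x : GaugeFun) ∈ 𝒟 := by
    intro K
    induction K with
    | zero => simpa using hf
    | succ K ih =>
      convert h𝒟.add_mem _ ih _ hf using 2 with x
      push_cast
      ring
  obtain ⟨K, hK⟩ := ENNReal.exists_nat_gt hc.ne
  have hf' := h𝒟.control f hf
  refine h𝒟.mem_of_le _ (hnat K) _
    ⟨fun x y h => mul_le_mul_right (hf'.1 h) c, fun x => ENNReal.mul_pos hc0.ne' (hf'.2 x).ne'⟩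
    fun x => ?_
  gcongr
  exact hK.le.trans (by exact_mod_cast K.le_succ)

theorem IsScale.controlSeq_mem {𝒟 : Set GaugeFun} (h𝒟 : IsScale 𝒟) {D : GaugeFun} (hD : D ∈ 𝒟)
    {p : ℝ≥0∞} {n N : ℕ} (hn : 1 ≤ n) (hN : 1 ≤ N) (e : ℕ → ℕ) (k : ℕ) (hk : 1 ≤ k) :
    controlSeq p n N e D k ∈ 𝒟 := by
  have hpow : ∀ (j : ℕ) (s : ℝ), 1 ≤ j → 0 < (j : ℝ≥0∞) ^ s ∧ (j : ℝ≥0∞) ^ s < ∞ := by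
    intro j s hj
    have h0 : (j : ℝ≥0∞) ≠ 0 := by simp; omega
    exact ⟨ENNReal.rpow_pos h0.bot_lt (by simp),
      (ENNReal.rpow_ne_top_of_ne_zero h0 (by simp)).lt_top⟩
  have hn0 : (0 : ℝ≥0∞) < n := by exact_mod_cast hn
  have hN0 : (0 : ℝ≥0∞) < N := by exact_mod_cast hN
  induction k, hk using Nat.le_induction with
  | base =>
    obtain ⟨h0, h1⟩ := hpow n (1 - (p⁻¹).toReal) hn
    exact h𝒟.comp_mem _ hD _ (h𝒟.const_mul_mem h𝒟.id_mem h0 h1)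
  | succ k hk ih =>
    obtain ⟨k, rfl⟩ : ∃ j, k = j + 1 := ⟨k - 1, by omega⟩
    have hη := h𝒟.const_mul_mem h𝒟.id_mem (c := 2 * n * N * 3 ^ e (k + 2)) (by positivity)
      (by finiteness)
    have hδ := h𝒟.add_mem _ (h𝒟.comp_mem _ hD _ hη) _ hη
    obtain ⟨h0, h1⟩ := hpow (k + 2) (p⁻¹).toReal (by omega)
    have hcδ := h𝒟.const_mul_mem hδ h0 h1
    have h2cδ := h𝒟.const_mul_mem hcδ (c := 2) (by norm_num) (by norm_num)
    have hε := h𝒟.const_mul_mem h𝒟.id_mem (c := 2 + 4 * n * N) (by positivity) (by finiteness)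
    have hε' := h𝒟.const_mul_mem h𝒟.id_mem (c := 2 * (1 + n * N)) (by positivity) (by finiteness)
    have := h𝒟.add_mem _ (h𝒟.add_mem _ hε _ h2cδ) _ (h𝒟.comp_mem _ ih _ (h𝒟.add_mem _ hε' _ hcδ))
    convert this using 1
    funext x
    simp only [controlSeq]
    congr 2
    · ring
    · congr 1
      ring

theorem IsScale.classDim_le {𝒟 : Set GaugeFun} {D : GaugeFun} (hD : D ∈ 𝒟) (Z : Type u)
    [PseudoEMetricSpace Z] : classDim 𝒟 Z ≤ controlledDim D Z :=
  csInf_le' ⟨D, hD, rfl⟩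

end Scales

/-! ### The dimension estimates -/

section Estimates

variable {F : Type u ⥤ Type u} [FiniteSupports F] {X : Type u} [PseudoEMetricSpace X]

theorem controlledDim_lpSub_le {p : ℝ≥0∞} {D : GaugeFun} {k : ℕ} {J : Type*} {κ : Cardinal.{u}}
    (f : J ↪ (1 + κ).out)
    (h : ∀ ε : Set.Ioi (0 : ℝ), Cov (suppLE F p X k) J (ENNReal.ofReal ε) (D ε)) :
    controlledDim D (LpSub F p X k) ≤ κ :=
  controlledDim_le_of_cov f fun ε => (h ε).subtype

theorem nonempty_fin_embedding (k m : ℕ) :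
    Nonempty (Fin (k * m + 1) ↪ (1 + (k : Cardinal.{u}) * (m : Cardinal.{u})).out) := by
  obtain ⟨f⟩ := nonempty_equiv_fin.{u} (k * m)
  rw [Nat.cast_mul] at f
  exact ⟨f.symm.toEmbedding⟩

/-- If the degree of `F` is zero, then `F^p X` is a discrete space with infinite distances. -/
theorem controlledDim_lpSpace_of_deg_eq_zero {p : ℝ≥0∞} (hp : 1 ≤ p) (hdeg : HasFiniteDegree F)
    (h0 : deg F = 0) (D : GaugeFun) : controlledDim D (LpSpace F p X) = 0 := by
  have hd := hasDegreeLE_deg hdeg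
  refine le_antisymm (controlledDim_le_of_cov (.refl _) fun ε => ?_) zero_le
  rw [h0] at hd
  rw [← suppLE_eq_univ hd]
  exact (cov_supp_empty hp le_rfl (hd.mono zero_le)).mono subset_rfl le_rfl zero_le

theorem controlledDim_lpSpace_le_of_finite {p : ℝ≥0∞} (hp : 1 ≤ p) (hF : IsFinitary F)
    (hdeg : HasFiniteDegree F) {D : GaugeFun} {m : ℕ} (hm : controlledDim D X = m) :
    controlledDim (controlSeq p (max 1 (deg F)) (Nat.card (F.obj (Ord.{u} (max 1 (deg F)))))
      (fun k => k * m - m + 1) D (max 1 (deg F))) (LpSpace F p X) ≤ deg F * (m : Cardinal.{u}) := by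
  rcases Nat.eq_zero_or_pos (deg F) with h0 | h0
  · rw [controlledDim_lpSpace_of_deg_eq_zero hp hdeg h0]
    exact zero_le
  have hd := hasDegreeLE_deg hdeg
  rw [max_eq_right (by omega)]
  obtain ⟨f⟩ := nonempty_fin_embedding.{u} (deg F) m
  refine controlledDim_le_of_cov f fun ε => ?_
  rw [← suppLE_eq_univ hd]
  exact cov_suppLE_of_finite hp h0 hd hF hm _ ε

theorem controlledDim_lpSpace_le_of_infinite {p : ℝ≥0∞} (hp : 1 ≤ p) (hF : IsFinitary F)
    (hdeg : HasFiniteDegree F) {D : GaugeFun} (hD : Cardinal.aleph0 ≤ controlledDim D X) :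
    controlledDim (controlSeq p (max 1 (deg F)) (Nat.card (F.obj (Ord.{u} (max 1 (deg F)))))
      (fun k => k ^ 2 - 2 * k + 2) D (max 1 (deg F))) (LpSpace F p X) ≤ controlledDim D X := by
  have hd := (hasDegreeLE_deg hdeg).mono (le_max_right 1 (deg F))
  refine controlledDim_le_of_cov (.refl _) fun ε => ?_
  rw [← suppLE_eq_univ hd]
  exact cov_suppLE_of_infinite hp (le_max_left _ _) hd hF hD _ ε

theorem classDim_lpSpace_le {p : ℝ≥0∞} (hp : 1 ≤ p) (hF : IsFinitary F)
    (hdeg : HasFiniteDegree F) {𝒟 : Set GaugeFun} (h𝒟 : IsScale 𝒟) :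
    classDim 𝒟 (LpSpace F p X) ≤ deg F * classDim 𝒟 X := by
  rcases Nat.eq_zero_or_pos (deg F) with h0 | h0
  · refine (IsScale.classDim_le h𝒟.id_mem _).trans ?_
    rw [controlledDim_lpSpace_of_deg_eq_zero hp hdeg h0]
    exact zero_le
  rcases isEmpty_or_one_le_card hF p (le_max_left 1 (deg F)) X with h | hN
  · exact (IsScale.classDim_le h𝒟.id_mem _).trans
      (controlledDim_le_of_cov (.refl _) fun ε => cov_of_isEmpty)
  obtain ⟨D, hD, hDX : controlledDim D X = classDim 𝒟 X⟩ :=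
    csInf_mem (s := (fun D => controlledDim D X) '' 𝒟) ⟨_, _, h𝒟.id_mem, rfl⟩
  rw [← hDX]
  have hmem := fun e => h𝒟.controlSeq_mem hD (p := p) (le_max_left 1 (deg F)) hN e _
    (le_max_left 1 (deg F))
  rcases lt_or_ge (controlledDim D X) Cardinal.aleph0 with hlt | hge
  · obtain ⟨m, hm⟩ := Cardinal.lt_aleph0.1 hlt
    rw [hm]
    exact (IsScale.classDim_le (hmem _) _).trans
      (controlledDim_lpSpace_le_of_finite hp hF hdeg hm)
  · refine (IsScale.classDim_le (hmem _) _).trans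
      ((controlledDim_lpSpace_le_of_infinite hp hF hdeg hge).trans ?_)
    exact le_mul_of_one_le_left' (by exact_mod_cast h0)

end Estimates

end LpMetr

theorem theoremt (F : Type u ⥤ Type u) [LpMetr.FiniteSupports F]
    (hF : LpMetr.IsFinitary F) (hdeg : LpMetr.HasFiniteDegree F)
    (p : ℝ≥0∞) (hp : 1 ≤ p) :
    -- the inequality for all dimension controlling scales
    (∀ 𝒟 : Set LpMetr.GaugeFun, LpMetr.IsScale 𝒟 →
      ∀ (X : Type u) [PseudoEMetricSpace X],
        LpMetr.classDim 𝒟 (LpMetr.LpSpace F p X) ≤ LpMetr.deg F * LpMetr.classDim 𝒟 X) ∧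
    -- explicit control, finite dimension
    (∀ D : LpMetr.GaugeFun, LpMetr.IsControl D →
      ∀ (X : Type u) [PseudoEMetricSpace X] (m n N : ℕ) (E : ℕ → LpMetr.GaugeFun),
        LpMetr.controlledDim D X = m → n = max 1 (LpMetr.deg F) →
        N = Nat.card (F.obj (LpMetr.Ord n)) →
        E = LpMetr.controlSeq p n N (fun k => k * m - m + 1) D →
          (∀ k ≤ LpMetr.deg F, LpMetr.controlledDim (E k) (LpMetr.LpSub F p X k) ≤
            k * LpMetr.controlledDim D X) ∧
          LpMetr.controlledDim (E n) (LpMetr.LpSpace F p X) ≤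
            LpMetr.deg F * LpMetr.controlledDim D X) ∧
    -- explicit control, infinite dimension
    (∀ D : LpMetr.GaugeFun, LpMetr.IsControl D →
      ∀ (X : Type u) [PseudoEMetricSpace X] (n N : ℕ) (E : ℕ → LpMetr.GaugeFun),
        Cardinal.aleph0 ≤ LpMetr.controlledDim D X → n = max 1 (LpMetr.deg F) →
        N = Nat.card (F.obj (LpMetr.Ord n)) →
        E = LpMetr.controlSeq p n N (fun k => k ^ 2 - 2 * k + 2) D →
          (∀ k ≤ LpMetr.deg F, LpMetr.controlledDim (E k) (LpMetr.LpSub F p X k) ≤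
            LpMetr.controlledDim D X) ∧
          LpMetr.controlledDim (E n) (LpMetr.LpSpace F p X) ≤ LpMetr.controlledDim D X) ∧
    -- the special cases
    (LpMetr.IsScale LpMetr.scaleAN ∧ LpMetr.IsScale LpMetr.scaleAS ∧
      LpMetr.IsScale LpMetr.scaleU ∧
      ∀ (X : Type u) [PseudoEMetricSpace X],
        LpMetr.classDim LpMetr.scaleAN (LpMetr.LpSpace F p X) ≤
          LpMetr.deg F * LpMetr.classDim LpMetr.scaleAN X ∧
        LpMetr.classDim LpMetr.scaleAS (LpMetr.LpSpace F p X) ≤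
          LpMetr.deg F * LpMetr.classDim LpMetr.scaleAS X ∧
        LpMetr.classDim LpMetr.scaleU (LpMetr.LpSpace F p X) ≤
          LpMetr.deg F * LpMetr.classDim LpMetr.scaleU X) := by
  open LpMetr in
  refine ⟨fun 𝒟 h𝒟 X _ => classDim_lpSpace_le hp hF hdeg h𝒟, ?_, ?_,
    isScale_scaleAN, isScale_scaleAS, isScale_scaleU, fun X _ =>
      ⟨classDim_lpSpace_le hp hF hdeg isScale_scaleAN,
        classDim_lpSpace_le hp hF hdeg isScale_scaleAS,
        classDim_lpSpace_le hp hF hdeg isScale_scaleU⟩⟩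
  · rintro D - X _ m _ _ _ hm rfl rfl rfl
    have hd := (hasDegreeLE_deg hdeg).mono (le_max_right 1 (deg F))
    rw [hm]
    refine ⟨fun k _ => ?_, controlledDim_lpSpace_le_of_finite hp hF hdeg hm⟩
    obtain ⟨f⟩ := nonempty_fin_embedding.{u} k m
    exact controlledDim_lpSub_le f fun ε =>
      cov_suppLE_of_finite hp (le_max_left _ _) hd hF hm k ε
  · rintro D - X _ _ _ _ hD rfl rfl rfl
    have hd := (hasDegreeLE_deg hdeg).mono (le_max_right 1 (deg F))
    exact ⟨fun k _ => controlledDim_lpSub_le (.refl _) fun ε =>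
      cov_suppLE_of_infinite hp (le_max_left _ _) hd hF hD k ε,
      controlledDim_lpSpace_le_of_infinite hp hF hdeg hD⟩
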